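/- **Setting.** Let $\mathbb D^2=\{z\in\mathbb C^2: |z_1|<1,\ |z_2|<1\}$ be the bidisk and $\mathbb T^2=\{\zeta\in\mathbb C^2: |\zeta_1|=|\zeta_2|=1\}$ the torus with normalized Lebesgue measure. Let $\phi:\mathbb D^2\to\mathbb C$ be an inner function, i.e. a bounded holomorphic function whose non-tangential limits on $\mathbb T^2$ exist and are unimodular almost everywhere, and let $\alpha\in\mathbb C$ with $|\alpha|=1$ and $\phi\not\equiv\alpha$. The Clark measure $\sigma_\alpha$ is the finite positive Borel measure on $\mathbb T^2$ with $$\frac{1-|\phi(z)|^2}{|\alpha-\phi(z)|^2}=\int_{\mathbb T^2}\frac{1-|z_1|^2}{|\zeta_1-z_1|^2}\,\frac{1-|z_2|^2}{|\zeta_2-z_2|^2}\,d\sigma_\alpha(\zeta),\qquad z\in\mathbb D^2 .$$ Identify $H^2=H^2(\mathbb D^2)$, through boundary functions and Cauchy integrals, with the space of those $f\in L^2(\mathbb T^2)$ whose Fourier coefficients vanish at all $(m,n)\in\mathbb Z^2$ with $m<0$ or $n<0$. Bounded holomorphic functions on $\mathbb D^2$ are likewise identified with their boundary functions. Let $H^2_2$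 be the closed span of $1,z_2,z_2^2,\dots$ in $H^2$, let $K_\phi=H^2\ominus\phi H^2$ be the model space of $\phi$, and let $P_\phi$ and $P_{H^2_2}$ be the orthogonal projections of $L^2(\mathbb T^2)$ onto $K_\phi$ and $H^2_2$. The compressed shift $S^1_\phi$ on $K_\phi$ is $S^1_\phi f=P_\phi(z_1f)$. For $w\in\mathbb D^2$ put $$k_w(z)=\frac1{(1-z_1\bar w_1)(1-z_2\bar w_2)},\qquad k^\phi_w(z)=\bigl(1-\phi(z)\overline{\phi(w)}\bigr)k_w(z).$$ The functions $k_w^\phi$ belong to $K_\phi$ and span a dense subspace of it. The Clark embedding $J_\alpha:K_\phi\to L^2(\sigma_\alpha)$ is the continuous linear extension of the map $$J_\alpha k^\phi_w=\bigl(1-\alpha\overline{\phi(w)}\bigr)k_w ,\qquad w\in\mathbb D^2 .$$ (It is an isometry, but need not be surjective.) Finally let $$\psi^1_\alpha(z)=\bar\alpha\,\frac{(B_1\phi)(z)}{1-\bar\alpha\,\phi(0,z_2)},\qquad (B_1\phi)(z)=\frac{\phi(z)-\phi(0,z_2)}{z_1},\qquad z\in\mathbb D^2,$$ where $(B_1\phi)(0,z_2)=\frac{\partial\phi}{\partial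 z_1}(0,z_2)$, and let $M_{\overline{\psi^1_\alpha}}$ denote multiplication by the complex conjugate of (the boundary function of) $\psi^1_\alpha$ on $L^2(\mathbb T^2)$. **Theorem.** Suppose that $J_\alpha:K_\phi\to L^2(\sigma_\alpha)$ is surjective and that $\psi^1_\alpha$ is bounded on $\mathbb D^2$. Then the operator $$U^1_\alpha=S^1_\phi+P_\phi\,P_{H^2_2}\,M_{\overline{\psi^1_\alpha}}$$ on $K_\phi$ is unitary, and the operator $M_{z_1}$ of multiplication by the first coordinate function on $L^2(\sigma_\alpha)$ satisfies $$M_{z_1}=J_\alpha\,U^1_\alpha\,J_\alpha^* .$$ -/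

import Mathlib

open MeasureTheory Filter Topology Set
open scoped ENNReal ComplexConjugate

noncomputable section

namespace ClarkBidisk

/-- The open unit bidisk. -/
def bidisk : Set (ℂ × ℂ) := {z | ‖z.1‖ < 1 ∧ ‖z.2‖ < 1}

/-- The distinguished boundary of the bidisk, the torus of pairs of unimodular numbers. -/
abbrev Torus : Type := Circle × Circle

/-- The unit circle carries its Borel σ-algebra. -/
instance : MeasurableSpace Circle := borel Circle

instance : BorelSpace Circle := ⟨rfl⟩

/-- Normalized Lebesgue measure on the unit circle: the image of normalized Lebesgue measure
on `(0, 2π]` under `θ ↦ exp (iθ)`. -/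
def circleMeasure : Measure Circle :=
  (ENNReal.ofReal (2 * Real.pi))⁻¹ •
    (volume.restrict (Ioc (0 : ℝ) (2 * Real.pi))).map (fun θ => Circle.exp θ)

/-- Normalized Lebesgue measure on the torus. -/
def torusMeasure : Measure Torus := circleMeasure.prod circleMeasure

/-- The complex Hilbert space of square integrable functions with respect to a measure `μ` on
the torus. -/
abbrev L2 (μ : Measure Torus) : Type := Lp ℂ 2 μ

/-! ### Multiplication operators -/

open Classical in
/-- The operator `f ↦ g f` of multiplication by an essentially bounded function `g` (it is set
to be `0` when `g` is not essentially bounded). -/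
def mulOp (μ : Measure Torus) (g : Torus → ℂ) : L2 μ →L[ℂ] L2 μ :=
  if h : MemLp g ∞ μ then
    (ContinuousLinearMap.mul ℂ ℂ).holderL μ ∞ 2 2 (h.toLp g)
  else 0

/-! ### Hardy spaces, as subspaces of `L²` of the torus -/

/-- The trigonometric monomial with exponent `(m, n)`. -/
def monomial (m n : ℤ) : C(Torus, ℂ) where
  toFun ζ := ((ζ.1 ^ m * ζ.2 ^ n : Circle) : ℂ)
  continuous_toFun := by
    have h : Continuous fun ζ : Torus => (ζ.1 ^ m * ζ.2 ^ n : Circle) :=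
      (continuous_fst.zpow m).mul (continuous_snd.zpow n)
    exact continuous_subtype_val.comp h

instance : IsFiniteMeasure circleMeasure := by
  refine ⟨?_⟩
  rw [circleMeasure, Measure.smul_apply, smul_eq_mul]
  refine ENNReal.mul_lt_top ?_ (measure_lt_top _ _)
  exact ENNReal.inv_lt_top.2 (ENNReal.ofReal_pos.2 (by positivity))

instance : IsFiniteMeasure torusMeasure := by
  unfold torusMeasure; infer_instance

/-- The class of a continuous function on the torus in `L²(μ)`. -/
abbrev toL2 (μ : Measure Torus) [IsFiniteMeasure μ] (g : C(Torus, ℂ)) : L2 μ :=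
  ContinuousMap.toLp 2 μ ℂ g

/-- The Hardy space of the bidisk, identified with the space of all `f` in `L²` of the torus
whose Fourier coefficients vanish at every `(m, n)` with `m < 0` or `n < 0`. -/
def hardy : Submodule ℂ (L2 torusMeasure) :=
  (Submodule.span ℂ {e | ∃ m n : ℤ, (m < 0 ∨ n < 0) ∧ e = toL2 torusMeasure (monomial m n)})ᗮ

/-- The one-variable Hardy space in the variable `z₂`: the closed span of `1, z₂, z₂², …`. -/
def hardyTwo : Submodule ℂ (L2 torusMeasure) :=
  (Submodule.span ℂ
    {e | ∃ n : ℕ, e = toL2 torusMeasure (monomial 0 n)}).topologicalClosure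

instance : CompleteSpace hardyTwo :=
  (Submodule.isClosed_topologicalClosure _).completeSpace_coe

/-- The Szegő kernel `k_w(ζ) = 1 / ((1 - ζ₁ w̄₁) (1 - ζ₂ w̄₂))`, as a function of `ζ` on the
torus, for `w` in the bidisk. -/
def szego (w : bidisk) : C(Torus, ℂ) where
  toFun ζ := 1 / ((1 - (ζ.1 : ℂ) * conj w.1.1) * (1 - (ζ.2 : ℂ) * conj w.1.2))
  continuous_toFun := by
    have key : ∀ (ζ : Circle) (a : ℂ), ‖a‖ < 1 → 1 - (ζ : ℂ) * conj a ≠ 0 := by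
      intro ζ a ha h
      have h1 : ‖(ζ : ℂ) * conj a‖ = 1 := by rw [← sub_eq_zero.1 h]; simp
      rw [norm_mul, Circle.norm_coe, one_mul, RCLike.norm_conj] at h1
      exact ha.ne h1
    exact Continuous.div continuous_const (by fun_prop)
      fun ζ => mul_ne_zero (key _ _ w.2.1) (key _ _ w.2.2)

/-- `b` is the boundary function of `f`: it belongs to the Hardy space and its Cauchy integral
`∫ b conj(k_z)` is `f z`, at every point `z` of the bidisk. There is at most one such `b`. -/
def IsBoundaryFunction (f : ℂ × ℂ → ℂ) (b : L2 torusMeasure) : Prop :=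
  b ∈ hardy ∧ ∀ z : bidisk, f z = ∫ ζ, b ζ * conj (szego z ζ) ∂torusMeasure

open Classical in
/-- The boundary function on the torus of a function on the bidisk (in particular, of a bounded
holomorphic function); it is set to be `0` for functions that do not have one. -/
def boundaryFunction (f : ℂ × ℂ → ℂ) : L2 torusMeasure :=
  if h : ∃ b, IsBoundaryFunction f b then h.choose else 0

/-! ### Inner functions and Clark measures -/

/-- The function `f` on the bidisk has the non-tangential limit `l` at the point `ζ` of the
torus: `f z → l` as `z → ζ` with each coordinate `z_j` confined to a Stolz region at `ζ_j` of
arbitrary aperture. -/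
def HasNontangentialLimit (f : ℂ × ℂ → ℂ) (ζ : Torus) (l : ℂ) : Prop :=
  ∀ c : ℝ, 1 < c →
    Tendsto f
      (𝓝[{z | z ∈ bidisk ∧ ‖z.1 - ζ.1‖ ≤ c * (1 - ‖z.1‖) ∧ ‖z.2 - ζ.2‖ ≤ c * (1 - ‖z.2‖)}]
        ((ζ.1 : ℂ), (ζ.2 : ℂ)))
      (𝓝 l)

/-- `f` is bounded on the bidisk. -/
def BoundedOnBidisk (f : ℂ × ℂ → ℂ) : Prop := ∃ C : ℝ, ∀ z ∈ bidisk, ‖f z‖ ≤ C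

/-- Inner functions: bounded holomorphic functions on the bidisk with unimodular non-tangential
limits at almost every point of the torus. -/
structure IsInner (φ : ℂ × ℂ → ℂ) : Prop where
  differentiableOn : DifferentiableOn ℂ φ bidisk
  bounded : BoundedOnBidisk φ
  unimodular : ∀ᵐ ζ ∂torusMeasure, ∃ l : ℂ, HasNontangentialLimit φ ζ l ∧ ‖l‖ = 1

/-- The Poisson kernel `P_z(ζ)` of the unit disk. -/
def poisson (z : ℂ) (ζ : Circle) : ℝ := (1 - ‖z‖ ^ 2) / ‖(ζ : ℂ) - z‖ ^ 2

/-- `σ` is the Clark measure of `φ` at the unimodular number `α`. -/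
def IsClarkMeasure (φ : ℂ × ℂ → ℂ) (α : Circle) (σ : Measure Torus) : Prop :=
  ∀ z ∈ bidisk,
    (1 - ‖φ z‖ ^ 2) / ‖(α : ℂ) - φ z‖ ^ 2 = ∫ ζ, poisson z.1 ζ.1 * poisson z.2 ζ.2 ∂σ

/-! ### Model spaces and compressed shifts -/

/-- The subspace `φ H²` of the Hardy space `H²` of the bidisk. -/
def phiHardy (φ : ℂ × ℂ → ℂ) : Submodule ℂ (L2 torusMeasure) :=
  hardy.map (mulOp torusMeasure (boundaryFunction φ)).toLinearMap

/-- The model space `K_φ = H² ⊖ φ H²`. -/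
def modelSpace (φ : ℂ × ℂ → ℂ) : Submodule ℂ (L2 torusMeasure) := hardy ⊓ (phiHardy φ)ᗮ

instance (φ : ℂ × ℂ → ℂ) : CompleteSpace (modelSpace φ) :=
  (IsClosed.inter (Submodule.isClosed_orthogonal _)
    (Submodule.isClosed_orthogonal _)).completeSpace_coe

/-- The orthogonal projection `P_φ` onto the model space. -/
abbrev projModel (φ : ℂ × ℂ → ℂ) : L2 torusMeasure →L[ℂ] modelSpace φ :=
  (modelSpace φ).orthogonalProjectionOnto

/-- The compressed shift `S¹_φ f = P_φ (z₁ f)` on the model space. -/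
def compressedShift (φ : ℂ × ℂ → ℂ) : modelSpace φ →L[ℂ] modelSpace φ :=
  projModel φ ∘L mulOp torusMeasure (fun ζ => (ζ.1 : ℂ)) ∘L (modelSpace φ).subtypeL

/-! ### The Clark embedding -/

/-- The reproducing kernel `k^φ_w = (1 - φ conj(φ(w))) k_w` of the model space. For inner `φ` this
function belongs to the model space, so that the projection `P_φ` leaves it as it is and only
serves to regard it as an element of that space. -/
def modelKernel (φ : ℂ × ℂ → ℂ) (w : bidisk) : modelSpace φ :=
  projModel φ
    (toL2 torusMeasure (szego w) -
      conj (φ w) • mulOp torusMeasure (boundaryFunction φ) (toL2 torusMeasure (szego w)))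

/-- The Clark embedding `J_α : K_φ → L²(σ)`: the continuous linear extension of
`k^φ_w ↦ (1 - α conj(φ(w))) k_w`, `w` in the bidisk, from the (dense) linear span of the
reproducing kernels `k^φ_w`. -/
def clarkEmbedding (φ : ℂ × ℂ → ℂ) (α : Circle) (σ : Measure Torus) [IsFiniteMeasure σ] :
    modelSpace φ →L[ℂ] L2 σ :=
  (Finsupp.linearCombination ℂ
      (fun w : bidisk => (1 - (α : ℂ) * conj (φ w)) • toL2 σ (szego w))).extendOfNorm
    (Finsupp.linearCombination ℂ (modelKernel φ))

/-! ### The Clark unitary -/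

/-- The backward shift in `z₁`: `(B₁ f)(z) = (f(z) - f(0, z₂)) / z₁`, which for `z₁ = 0` is to be
read as the derivative of `f` in `z₁` at `(0, z₂)`. -/
def backwardShift (f : ℂ × ℂ → ℂ) (z : ℂ × ℂ) : ℂ := dslope (fun s => f (s, z.2)) 0 z.1

/-- The function `ψ¹_α = conj(α) B₁φ / (1 - conj(α) φ(0, z₂))` on the bidisk. -/
def psi (φ : ℂ × ℂ → ℂ) (α : Circle) (z : ℂ × ℂ) : ℂ :=
  conj (α : ℂ) * (backwardShift φ z / (1 - conj (α : ℂ) * φ (0, z.2)))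

/-- The operator `U¹_α = S¹_φ + P_φ P M` on the model space, where `M` is multiplication by the
complex conjugate of (the boundary function of) `ψ¹_α` on `L²` of the torus and `P` is the
orthogonal projection of that space onto the Hardy space in the variable `z₂`. -/
def clarkUnitary (φ : ℂ × ℂ → ℂ) (α : Circle) : modelSpace φ →L[ℂ] modelSpace φ :=
  compressedShift φ +
    projModel φ ∘L hardyTwo.starProjection ∘L
      mulOp torusMeasure (fun ζ => conj (boundaryFunction (psi φ α) ζ)) ∘L
        (modelSpace φ).subtypeL

end ClarkBidisk

end

open scoped InnerProductSpace

noncomputable section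

namespace ClarkBidisk

/-! ### Integration on the circle and the torus -/

/-! Write `J`, `U`, `ψ` for the Clark embedding, `U¹_α`, `ψ¹_α`. The heart of the proof is the
identity `U = J* M_{z₁} J` (`IsClarkMeasure.clarkUnitary_eq`), which holds whether or not `J` is
surjective. Surjectivity only upgrades the isometry `J` to a unitary operator; then `U` is a unitary
conjugate of multiplication by a unimodular function, and both assertions follow.

That `J` is isometric comes from polarization. The Clark formula gives the norm of each `k_z` in
`L²(σ)`. Its cleared form extends to a function holomorphic in `z` and `u = conj w`, and such a
function is determined by its values on `u = conj z`. This yields all inner products `⟨k_z, k_w⟩` in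
`L²(σ)` (`IsClarkMeasure.inner_szego`), and the Gram matrix of the vectors `J k^φ_w` agrees with
that of the `k^φ_w`.

The identity for `U` is checked against the kernels `k^φ_w`. From `φ = φ(0,·) + z₁ (α - φ(0,·)) ψ`
one obtains `⟨k^φ_w, U f⟩ = w₁ ⟨k^φ_w, f⟩ + (1 - conj α φ(w)) ⟨ψ k_(0,w₂), f⟩`
(`IsInner.inner_modelKernel_clarkUnitary`). On the `L²(σ)` side, `conj ζ₁ k_w = conj w₁ k_w + conj
ζ₁ k_(0,w₂)` gives the same expression once `J* (conj ζ₁ k_(0,w₂)) = ψ k_(0,w₂)` is known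
(`IsClarkMeasure.adjoint_clarkEmbedding_star_coordOne`).

The rest is Hardy space theory: Cauchy integrals determine elements of `H²` (`eq_of_cauchyEval`),
bounded elements multiply `H²` into itself (`mulOp_mem_hardy_and_cauchyEval`), bounded functions
have boundary functions (`SliceHolomorphic.exists_boundaryFunction`), and those of inner functions
are unimodular (`IsInner.exists_boundaryFunction`). -/

theorem integral_circleMeasure {F : ℂ → ℂ} (hF : Continuous fun ζ : Circle => F ζ) :
    ∫ ζ : Circle, F ζ ∂circleMeasure = Real.circleAverage F 0 1 := by
  have hexp : Measurable fun θ : ℝ => Circle.exp θ := Circle.exp.continuous.measurable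
  rw [circleMeasure, integral_smul_measure, integral_map hexp.aemeasurable
    hF.aestronglyMeasurable, Real.circleAverage_def,
    intervalIntegral.integral_of_le (by positivity)]
  simp [circleMap, ENNReal.toReal_ofReal Real.pi_pos.le]

instance : IsProbabilityMeasure circleMeasure := by
  constructor
  rw [circleMeasure, Measure.smul_apply, Measure.map_apply Circle.exp.continuous.measurable
    MeasurableSet.univ]
  simp only [preimage_univ, Measure.restrict_apply_univ, Real.volume_Ioc, sub_zero, smul_eq_mul]
  exact ENNReal.inv_mul_cancel (by simp [Real.pi_pos]) ENNReal.ofReal_ne_top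

instance : IsProbabilityMeasure torusMeasure := by
  unfold torusMeasure; infer_instance

theorem one_sub_conj_mul_ne_zero (ζ : Circle) {a : ℂ} (ha : ‖a‖ < 1) :
    1 - conj (ζ : ℂ) * a ≠ 0 := by
  intro h
  have h1 : ‖conj (ζ : ℂ) * a‖ = 1 := by rw [← sub_eq_zero.1 h]; simp
  rw [norm_mul, RCLike.norm_conj, Circle.norm_coe, one_mul] at h1
  exact ha.ne h1

/-- Cauchy's integral formula for functions holomorphic in a neighborhood of the closed disk. -/
theorem integral_circle_cauchy {F : ℂ → ℂ} {R : ℝ} (hR : 1 < R)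
    (hF : DifferentiableOn ℂ F (Metric.ball 0 R)) {z : ℂ} (hz : ‖z‖ < 1) :
    ∫ ζ : Circle, F ζ * (1 / (1 - conj (ζ : ℂ) * z)) ∂circleMeasure = F z := by
  have hmem : ∀ ζ : Circle, (ζ : ℂ) ∈ Metric.ball (0 : ℂ) R := fun ζ => by
    rw [mem_ball_zero_iff, Circle.norm_coe]; exact hR
  have hcont : Continuous fun ζ : Circle => F ζ :=
    hF.continuousOn.comp_continuous continuous_subtype_val hmem
  have key : ∀ ζ : Circle, F ζ * (1 / (1 - conj (ζ : ℂ) * z)) =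
      (((ζ : ℂ) - 0) / ((ζ : ℂ) - z)) • F ζ := by
    intro ζ
    have h1 : (ζ : ℂ) * conj (ζ : ℂ) = 1 := by
      rw [Complex.mul_conj, Circle.normSq_coe]; simp
    have h2 : (ζ : ℂ) - z = ζ * (1 - conj (ζ : ℂ) * z) := by
      rw [mul_sub, mul_one, ← mul_assoc, h1, one_mul]
    have h3 := one_sub_conj_mul_ne_zero ζ hz
    rw [h2, smul_eq_mul, sub_zero]
    field_simp
  have hd : DiffContOnCl ℂ F (Metric.ball 0 |1|) := by
    refine DifferentiableOn.diffContOnCl (hF.mono ?_)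
    rw [abs_one, closure_ball _ one_ne_zero]
    exact Metric.closedBall_subset_ball hR
  rw [← hd.circleAverage_smul_div (w := z) (by simpa using hz)]
  rw [← integral_circleMeasure (F := fun w => ((w - 0) / (w - z)) • F w)]
  · exact integral_congr_ae (.of_forall key)
  · simp_rw [← key]
    refine hcont.mul (Continuous.div continuous_const ?_ fun ζ => one_sub_conj_mul_ne_zero ζ hz)
    fun_prop

theorem integral_circle_mul_pow {F : ℂ → ℂ} {R : ℝ} (hR : 1 < R)
    (hF : DifferentiableOn ℂ F (Metric.ball 0 R)) (n : ℕ) :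
    ∫ ζ : Circle, F ζ * (ζ : ℂ) ^ (n + 1) ∂circleMeasure = 0 := by
  have h := integral_circle_cauchy hR (F := fun w => F w * w ^ (n + 1))
    (hF.mul (by fun_prop)) (z := 0) (by simp)
  simpa using h

theorem integral_circle_zpow {n : ℤ} (hn : n ≠ 0) :
    ∫ ζ : Circle, ((ζ ^ n : Circle) : ℂ) ∂circleMeasure = 0 := by
  have hpos : ∀ k : ℕ, ∫ ζ : Circle, ((ζ : ℂ)) ^ (k + 1) ∂circleMeasure = 0 := fun k => by
    simpa using integral_circle_mul_pow (F := fun _ => 1) one_lt_two (by fun_prop) k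
  rcases lt_or_gt_of_ne hn with h | h
  · obtain ⟨k, rfl⟩ : ∃ k : ℕ, n = -((k + 1 : ℕ) : ℤ) :=
      ⟨(-n).toNat - 1, by omega⟩
    have : ∀ ζ : Circle, ((ζ ^ (-((k + 1 : ℕ) : ℤ)) : Circle) : ℂ) = conj ((ζ : ℂ) ^ (k + 1)) := by
      intro ζ
      rw [zpow_neg, zpow_natCast, Circle.coe_inv_eq_conj, Circle.coe_pow]
    simp_rw [this]
    rw [integral_conj, hpos, map_zero]
  · obtain ⟨k, rfl⟩ : ∃ k : ℕ, n = ((k + 1 : ℕ) : ℤ) := ⟨n.toNat - 1, by omega⟩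
    simp_rw [zpow_natCast, Circle.coe_pow]
    exact hpos k

theorem integral_monomial {m n : ℤ} (h : m ≠ 0 ∨ n ≠ 0) :
    ∫ ζ, monomial m n ζ ∂torusMeasure = 0 := by
  have : ∀ ζ : Torus, monomial m n ζ = ((ζ.1 ^ m : Circle) : ℂ) * ((ζ.2 ^ n : Circle) : ℂ) :=
    fun ζ => Circle.coe_mul _ _
  simp_rw [this]
  rw [torusMeasure, integral_prod_mul (fun x : Circle => ((x ^ m : Circle) : ℂ))
    (fun x : Circle => ((x ^ n : Circle) : ℂ))]
  rcases h with h | h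
  · rw [integral_circle_zpow h, zero_mul]
  · rw [integral_circle_zpow h, mul_zero]

/-! ### Trigonometric monomials -/

@[simp] theorem monomial_zero_zero : monomial 0 0 = 1 := by
  ext ζ; simp [monomial]

theorem monomial_mul (m n k l : ℤ) :
    monomial m n * monomial k l = monomial (m + k) (n + l) := by
  ext ζ
  simp only [monomial, ContinuousMap.mul_apply, ContinuousMap.coe_mk]
  rw [← Circle.coe_mul, zpow_add, zpow_add, mul_mul_mul_comm]

theorem star_monomial (m n : ℤ) : star (monomial m n) = monomial (-m) (-n) := by
  ext ζ
  simp only [monomial, ContinuousMap.star_apply, ContinuousMap.coe_mk]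
  rw [RCLike.star_def, ← Circle.coe_inv_eq_conj, mul_inv, zpow_neg, zpow_neg]

/-- The star subalgebra of trigonometric polynomials on the torus. -/
def trigSubalgebra : StarSubalgebra ℂ C(Torus, ℂ) where
  toSubalgebra := Algebra.adjoin ℂ (range fun p : ℤ × ℤ => monomial p.1 p.2)
  star_mem' := by
    change Algebra.adjoin ℂ (range fun p : ℤ × ℤ => monomial p.1 p.2) ≤
      star (Algebra.adjoin ℂ (range fun p : ℤ × ℤ => monomial p.1 p.2))
    refine Algebra.adjoin_le ?_
    rintro - ⟨p, rfl⟩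
    exact Algebra.subset_adjoin ⟨-p, (star_monomial _ _).symm⟩

theorem trigSubalgebra_coe :
    Subalgebra.toSubmodule trigSubalgebra.toSubalgebra =
      Submodule.span ℂ (range fun p : ℤ × ℤ => monomial p.1 p.2) := by
  apply Algebra.adjoin_eq_span_of_subset
  refine Subset.trans ?_ Submodule.subset_span
  intro x hx
  refine Submonoid.closure_induction (fun _ => id) ⟨0, monomial_zero_zero⟩ ?_ hx
  rintro - - - - ⟨p, rfl⟩ ⟨q, rfl⟩
  exact ⟨p + q, (monomial_mul _ _ _ _).symm⟩

/-- Stone–Weierstrass: the two coordinates separate the points of the torus. -/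
theorem span_monomial_closure_eq_top :
    (Submodule.span ℂ (range fun p : ℤ × ℤ => monomial p.1 p.2)).topologicalClosure = ⊤ := by
  rw [← trigSubalgebra_coe]
  refine congr_arg (Subalgebra.toSubmodule <| StarSubalgebra.toSubalgebra ·)
    (ContinuousMap.starSubalgebra_topologicalClosure_eq_top_of_separatesPoints trigSubalgebra ?_)
  intro x y hxy
  by_cases h : x.1 = y.1
  · refine ⟨_, ⟨monomial 0 1, Algebra.subset_adjoin ⟨(0, 1), rfl⟩, rfl⟩, fun h' => hxy ?_⟩
    exact Prod.ext h (Circle.ext (by simpa [monomial] using h'))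
  · refine ⟨_, ⟨monomial 1 0, Algebra.subset_adjoin ⟨(1, 0), rfl⟩, rfl⟩, fun h' => h (Circle.ext ?_)⟩
    simpa [monomial] using h'

/-- A square integrable function all of whose Fourier coefficients vanish is zero. -/
theorem eq_zero_of_inner_monomial {x : L2 torusMeasure}
    (h : ∀ m n : ℤ, ⟪toL2 torusMeasure (monomial m n), x⟫_ℂ = 0) : x = 0 := by
  have h1 : (⊤ : Submodule ℂ C(Torus, ℂ)) ≤
      ((ℂ ∙ x)ᗮ).comap (ContinuousMap.toLp (E := ℂ) 2 torusMeasure ℂ).toLinearMap := by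
    rw [← span_monomial_closure_eq_top]
    refine Submodule.topologicalClosure_minimal _ (Submodule.span_le.2 ?_) ?_
    · rintro - ⟨p, rfl⟩
      change _ ∈ (ℂ ∙ x)ᗮ
      rw [Submodule.mem_orthogonal_singleton_iff_inner_left]
      exact h _ _
    · exact (Submodule.isClosed_orthogonal _).preimage
        (ContinuousMap.toLp (E := ℂ) 2 torusMeasure ℂ).continuous
  have h2 : Dense (range (ContinuousMap.toLp (E := ℂ) 2 torusMeasure ℂ)) :=
    ContinuousMap.toLp_denseRange ℂ torusMeasure ℂ (by simp)
  refine h2.eq_zero_of_inner_right ℂ ?_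
  rintro v ⟨g, rfl⟩
  exact Submodule.mem_orthogonal_singleton_iff_inner_left.1 (h1 (Submodule.mem_top (x := g)))

/-! ### Multiplication operators -/

section MulOp

variable {μ : Measure Torus}

/-- Essential boundedness excludes the default value `0`; all further facts on `mulOp` rest on this
pointwise description. -/
theorem mulOp_ae {g : Torus → ℂ} (hg : MemLp g ∞ μ) (f : L2 μ) :
    mulOp μ g f =ᵐ[μ] fun ζ => g ζ * f ζ := by
  rw [mulOp, dif_pos hg]
  refine ((ContinuousLinearMap.mul ℂ ℂ).coeFn_holder (r := 2) (hg.toLp g) f).trans ?_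
  filter_upwards [hg.coeFn_toLp] with ζ hζ
  rw [hζ, ContinuousLinearMap.mul_apply']

theorem memLp_top_continuousMap (g : C(Torus, ℂ)) : MemLp g ∞ μ :=
  memLp_top_of_bound g.continuous.aestronglyMeasurable ‖g‖ (.of_forall g.norm_coe_le_norm)

theorem memLp_top_conj {g : Torus → ℂ} (hg : MemLp g ∞ μ) : MemLp (fun ζ => conj (g ζ)) ∞ μ :=
  hg.star

theorem inner_mulOp_left {g : Torus → ℂ} (hg : MemLp g ∞ μ) (x y : L2 μ) :
    ⟪mulOp μ g x, y⟫_ℂ = ⟪x, mulOp μ (fun ζ => conj (g ζ)) y⟫_ℂ := by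
  rw [L2.inner_def, L2.inner_def]
  refine integral_congr_ae ?_
  filter_upwards [mulOp_ae hg x, mulOp_ae (memLp_top_conj hg) y] with ζ h1 h2
  rw [h1, h2]
  simp only [RCLike.inner_apply, map_mul]
  ring

theorem inner_mulOp_right {g : Torus → ℂ} (hg : MemLp g ∞ μ) (x y : L2 μ) :
    ⟪x, mulOp μ g y⟫_ℂ = ⟪mulOp μ (fun ζ => conj (g ζ)) x, y⟫_ℂ := by
  rw [inner_mulOp_left (memLp_top_conj hg)]
  simp

theorem adjoint_mulOp {g : Torus → ℂ} (hg : MemLp g ∞ μ) :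
    ContinuousLinearMap.adjoint (mulOp μ g) = mulOp μ (fun ζ => conj (g ζ)) :=
  ((ContinuousLinearMap.eq_adjoint_iff _ _).2 fun x y => by
    rw [inner_mulOp_left (memLp_top_conj hg)]; simp).symm

theorem mulOp_comm {g h : Torus → ℂ} (hg : MemLp g ∞ μ) (hh : MemLp h ∞ μ) (f : L2 μ) :
    mulOp μ g (mulOp μ h f) = mulOp μ h (mulOp μ g f) := by
  refine Lp.ext ?_
  filter_upwards [mulOp_ae hg (mulOp μ h f), mulOp_ae hh (mulOp μ g f), mulOp_ae hg f,
    mulOp_ae hh f] with ζ h1 h2 h3 h4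
  rw [h1, h2, h3, h4]
  ring

theorem mulOp_conj_mulOp_of_norm_eq_one {g : Torus → ℂ} (hg : MemLp g ∞ μ)
    (h1 : ∀ᵐ ζ ∂μ, ‖g ζ‖ = 1) (f : L2 μ) :
    mulOp μ (fun ζ => conj (g ζ)) (mulOp μ g f) = f := by
  refine Lp.ext ?_
  filter_upwards [mulOp_ae (memLp_top_conj hg) (mulOp μ g f), mulOp_ae hg f, h1] with ζ h2 h3 h4
  rw [h2, h3, ← mul_assoc, Complex.conj_mul', h4]
  simp

theorem inner_mulOp_mulOp_of_norm_eq_one {g : Torus → ℂ} (hg : MemLp g ∞ μ)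
    (h1 : ∀ᵐ ζ ∂μ, ‖g ζ‖ = 1) (x y : L2 μ) : ⟪mulOp μ g x, mulOp μ g y⟫_ℂ = ⟪x, y⟫_ℂ := by
  rw [inner_mulOp_left hg, mulOp_conj_mulOp_of_norm_eq_one hg h1]

theorem mulOp_mem_unitary {g : Torus → ℂ} (hg : MemLp g ∞ μ) (h1 : ∀ᵐ ζ ∂μ, ‖g ζ‖ = 1) :
    mulOp μ g ∈ unitary (L2 μ →L[ℂ] L2 μ) := by
  have h2 : star (mulOp μ g) * mulOp μ g = 1 := by
    rw [ContinuousLinearMap.star_eq_adjoint, adjoint_mulOp hg]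
    ext1 f
    exact mulOp_conj_mulOp_of_norm_eq_one hg h1 f
  refine Unitary.mem_iff.2 ⟨h2, ?_⟩
  rw [← h2, ContinuousLinearMap.star_eq_adjoint, adjoint_mulOp hg]
  ext1 f
  exact mulOp_comm hg (memLp_top_conj hg) f

variable [IsFiniteMeasure μ]

theorem toL2_ae (g : C(Torus, ℂ)) : toL2 μ g =ᵐ[μ] g := ContinuousMap.coeFn_toLp μ g

theorem toL2_add (g h : C(Torus, ℂ)) : toL2 μ (g + h) = toL2 μ g + toL2 μ h := map_add _ g h

theorem toL2_sub (g h : C(Torus, ℂ)) : toL2 μ (g - h) = toL2 μ g - toL2 μ h := map_sub _ g h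

theorem toL2_smul (c : ℂ) (g : C(Torus, ℂ)) : toL2 μ (c • g) = c • toL2 μ g := map_smul _ c g

theorem mulOp_toL2 (g h : C(Torus, ℂ)) : mulOp μ g (toL2 μ h) = toL2 μ (g * h) := by
  refine Lp.ext ?_
  filter_upwards [mulOp_ae (memLp_top_continuousMap g) (toL2 μ h), toL2_ae (μ := μ) h,
    toL2_ae (μ := μ) (g * h)] with ζ h1 h2 h3
  rw [h1, h2, h3, ContinuousMap.mul_apply]

theorem inner_toL2_mulOp (g h : C(Torus, ℂ)) (f : L2 μ) :
    ⟪toL2 μ h, mulOp μ g f⟫_ℂ = ⟪toL2 μ (star g * h), f⟫_ℂ := by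
  rw [inner_mulOp_right (memLp_top_continuousMap g), ← mulOp_toL2]
  rfl

theorem inner_toL2 (g : C(Torus, ℂ)) (f : L2 μ) :
    ⟪toL2 μ g, f⟫_ℂ = ∫ ζ, f ζ * conj (g ζ) ∂μ := by
  rw [L2.inner_def]
  refine integral_congr_ae ?_
  filter_upwards [toL2_ae (μ := μ) g] with ζ h
  rw [h, RCLike.inner_apply]

theorem inner_toL2_toL2 (g h : C(Torus, ℂ)) :
    ⟪toL2 μ g, toL2 μ h⟫_ℂ = ∫ ζ, h ζ * conj (g ζ) ∂μ := by
  rw [inner_toL2]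
  refine integral_congr_ae ?_
  filter_upwards [toL2_ae (μ := μ) h] with ζ h
  rw [h]

end MulOp

/-! ### Szegő kernels -/

/-- The first coordinate function. -/
def coordOne : C(Torus, ℂ) := ⟨fun ζ => (ζ.1 : ℂ), by fun_prop⟩

/-- The second coordinate function. -/
def coordTwo : C(Torus, ℂ) := ⟨fun ζ => (ζ.2 : ℂ), by fun_prop⟩

@[simp] theorem coordOne_apply (ζ : Torus) : coordOne ζ = (ζ.1 : ℂ) := rfl

@[simp] theorem coordTwo_apply (ζ : Torus) : coordTwo ζ = (ζ.2 : ℂ) := rfl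

theorem coordOne_mul_monomial (m n : ℤ) : coordOne * monomial m n = monomial (m + 1) n := by
  rw [show coordOne = monomial 1 0 by ext ζ; simp [coordOne, monomial], monomial_mul,
    add_comm, zero_add]

theorem coordTwo_mul_monomial (m n : ℤ) : coordTwo * monomial m n = monomial m (n + 1) := by
  rw [show coordTwo = monomial 0 1 by ext ζ; simp [coordTwo, monomial], monomial_mul,
    zero_add, add_comm]

theorem star_coordOne_mul_monomial (m n : ℤ) :
    star coordOne * monomial m n = monomial (m - 1) n := by
  rw [show coordOne = monomial 1 0 by ext ζ; simp [coordOne, monomial], star_monomial,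
    monomial_mul]
  congr 1 <;> ring

theorem star_coordTwo_mul_monomial (m n : ℤ) :
    star coordTwo * monomial m n = monomial m (n - 1) := by
  rw [show coordTwo = monomial 0 1 by ext ζ; simp [coordTwo, monomial], star_monomial,
    monomial_mul]
  congr 1 <;> ring

/-- The projection `(w₁, w₂) ↦ (0, w₂)` of the bidisk. -/
def dropOne (w : bidisk) : bidisk := ⟨(0, w.1.2), by simp, w.2.2⟩

/-- The projection `(w₁, w₂) ↦ (w₁, 0)` of the bidisk. -/
def dropTwo (w : bidisk) : bidisk := ⟨(w.1.1, 0), w.2.1, by simp⟩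

theorem one_sub_mul_conj_ne_zero (ζ : Circle) {a : ℂ} (ha : ‖a‖ < 1) :
    1 - (ζ : ℂ) * conj a ≠ 0 := by
  have h := one_sub_conj_mul_ne_zero ζ ha
  rw [← (starRingEnd ℂ).injective.ne_iff] at h
  simpa using h

theorem szego_apply (w : bidisk) (ζ : Torus) :
    szego w ζ = 1 / ((1 - (ζ.1 : ℂ) * conj w.1.1) * (1 - (ζ.2 : ℂ) * conj w.1.2)) := rfl

theorem coe_mul_conj_coe (ζ : Circle) : (ζ : ℂ) * conj (ζ : ℂ) = 1 := by
  rw [Complex.mul_conj, Circle.normSq_coe]; simp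

/-- On the circle `conj ζ₁ = 1/ζ₁`, and the partial fraction of `1/(ζ₁ (1 - ζ₁ conj w₁))` has these
two terms. In `L²` of the torus the last one is orthogonal to `H²`, so `k_w` is an eigenvector of
the backward shift; in `L²(σ)` it survives and produces `ψ¹_α`. -/
theorem star_coordOne_mul_szego (w : bidisk) :
    star coordOne * szego w = conj w.1.1 • szego w + star coordOne * szego (dropOne w) := by
  ext ζ
  have h1 := one_sub_mul_conj_ne_zero ζ.1 w.2.1
  have h2 := one_sub_mul_conj_ne_zero ζ.2 w.2.2
  have h3 := coe_mul_conj_coe ζ.1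
  simp only [ContinuousMap.mul_apply, ContinuousMap.add_apply, ContinuousMap.smul_apply,
    ContinuousMap.star_apply, szego_apply, coordOne_apply, dropOne, map_zero,
    mul_zero, sub_zero, one_mul, RCLike.star_def, smul_eq_mul]
  field_simp
  linear_combination conj w.1.1 * h3

theorem star_coordTwo_mul_szego (w : bidisk) :
    star coordTwo * szego w = conj w.1.2 • szego w + star coordTwo * szego (dropTwo w) := by
  ext ζ
  have h1 := one_sub_mul_conj_ne_zero ζ.1 w.2.1
  have h2 := one_sub_mul_conj_ne_zero ζ.2 w.2.2
  have h3 := coe_mul_conj_coe ζ.2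
  simp only [ContinuousMap.mul_apply, ContinuousMap.add_apply, ContinuousMap.smul_apply,
    ContinuousMap.star_apply, szego_apply, coordTwo_apply, dropTwo, map_zero,
    mul_zero, sub_zero, mul_one, RCLike.star_def, smul_eq_mul]
  field_simp
  linear_combination conj w.1.2 * h3

/-- Amounts to `(1 - ζ₁ conj w₁) k_w = k_(0,w₂)`. It is kept free of division by `conj w₁`, so as to
be valid at `w₁ = 0`. -/
theorem conj_smul_coordOne_mul_szego (w : bidisk) :
    conj w.1.1 • (coordOne * szego w) = szego w - szego (dropOne w) := by
  ext ζ
  have h1 := one_sub_mul_conj_ne_zero ζ.1 w.2.1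
  have h2 := one_sub_mul_conj_ne_zero ζ.2 w.2.2
  simp only [ContinuousMap.mul_apply, ContinuousMap.sub_apply, ContinuousMap.smul_apply,
    szego_apply, coordOne_apply, dropOne, map_zero,
    mul_zero, sub_zero, one_mul, smul_eq_mul]
  rw [mul_comm (ζ.1 : ℂ)] at h1
  field_simp
  ring

theorem conj_smul_coordTwo_mul_szego (w : bidisk) :
    conj w.1.2 • (coordTwo * szego w) = szego w - szego (dropTwo w) := by
  ext ζ
  have h1 := one_sub_mul_conj_ne_zero ζ.1 w.2.1
  have h2 := one_sub_mul_conj_ne_zero ζ.2 w.2.2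
  simp only [ContinuousMap.mul_apply, ContinuousMap.sub_apply, ContinuousMap.smul_apply,
    szego_apply, coordTwo_apply, dropTwo, map_zero,
    mul_zero, sub_zero, mul_one, smul_eq_mul]
  rw [mul_comm (ζ.2 : ℂ)] at h2
  field_simp
  ring

/-- The analytic extension `(u, v) ↦ 1 / ((1 - ζ₁ u) (1 - ζ₂ v))` of the Szegő kernels, with
values in the Banach algebra of continuous functions on the torus. -/
def cauchyKernel (u : ℂ × ℂ) : C(Torus, ℂ) :=
  Ring.inverse ((1 - u.1 • coordOne) * (1 - u.2 • coordTwo))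

theorem norm_smul_coordOne_lt_one {a : ℂ} (ha : ‖a‖ < 1) : ‖a • coordOne‖ < 1 := by
  rw [ContinuousMap.norm_lt_iff _ one_pos]
  intro ζ
  simpa [Circle.norm_coe] using ha

theorem norm_smul_coordTwo_lt_one {a : ℂ} (ha : ‖a‖ < 1) : ‖a • coordTwo‖ < 1 := by
  rw [ContinuousMap.norm_lt_iff _ one_pos]
  intro ζ
  simpa [Circle.norm_coe] using ha

theorem isUnit_cauchyKernel_denom {u : ℂ × ℂ} (hu : u ∈ bidisk) :
    IsUnit ((1 - u.1 • coordOne) * (1 - u.2 • coordTwo)) :=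
  (isUnit_one_sub_of_norm_lt_one (norm_smul_coordOne_lt_one hu.1)).mul
    (isUnit_one_sub_of_norm_lt_one (norm_smul_coordTwo_lt_one hu.2))

theorem cauchyKernel_apply {u : ℂ × ℂ} (hu : u ∈ bidisk) (ζ : Torus) :
    cauchyKernel u ζ = 1 / ((1 - (ζ.1 : ℂ) * u.1) * (1 - (ζ.2 : ℂ) * u.2)) := by
  have h := congrArg (· ζ) (Ring.inverse_mul_cancel _ (isUnit_cauchyKernel_denom hu))
  have h1 := one_sub_mul_conj_ne_zero ζ.1 (a := conj u.1) (by simpa using hu.1)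
  have h2 := one_sub_mul_conj_ne_zero ζ.2 (a := conj u.2) (by simpa using hu.2)
  rw [Complex.conj_conj] at h1 h2
  rw [eq_div_iff (mul_ne_zero h1 h2)]
  simp only [ContinuousMap.mul_apply, ContinuousMap.sub_apply, ContinuousMap.one_apply,
    ContinuousMap.smul_apply, smul_eq_mul, coordOne_apply, coordTwo_apply] at h
  rw [cauchyKernel]
  linear_combination h

theorem isOpen_bidisk : IsOpen bidisk :=
  (isOpen_lt continuous_fst.norm continuous_const).inter
    (isOpen_lt continuous_snd.norm continuous_const)

theorem differentiableAt_cauchyKernel {u : ℂ × ℂ} (hu : u ∈ bidisk) :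
    DifferentiableAt ℂ cauchyKernel u := by
  have h := differentiableAt_inverse (𝕜 := ℂ) (isUnit_cauchyKernel_denom hu)
  refine DifferentiableAt.comp u h ?_
  fun_prop

theorem conj_mem_bidisk {z : ℂ × ℂ} (hz : z ∈ bidisk) : (conj z.1, conj z.2) ∈ bidisk := by
  simpa [bidisk] using hz

theorem szego_eq_cauchyKernel (w : bidisk) :
    szego w = cauchyKernel (conj w.1.1, conj w.1.2) := by
  ext ζ
  rw [cauchyKernel_apply (conj_mem_bidisk w.2), szego_apply]

theorem continuous_szego : Continuous szego := by
  rw [continuous_iff_continuousAt]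
  intro w
  rw [show szego = fun w => cauchyKernel (conj w.1.1, conj w.1.2) from
    funext szego_eq_cauchyKernel]
  refine ContinuousAt.comp (x := w) (g := cauchyKernel)
    (f := fun w : bidisk => (conj w.1.1, conj w.1.2))
    (differentiableAt_cauchyKernel (conj_mem_bidisk w.2)).continuousAt ?_
  fun_prop

/-- The geometric series converges in sup norm, hence in `L²` of any finite measure on the torus. -/
theorem hasSum_szego_dropOne (w : bidisk) :
    HasSum (fun n : ℕ => conj w.1.2 ^ n • monomial 0 n) (szego (dropOne w)) := by
  have hn : ‖conj w.1.2 • coordTwo‖ < 1 :=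
    norm_smul_coordTwo_lt_one (by simpa using w.2.2)
  have h := (summable_geometric_of_norm_lt_one hn).hasSum
  have h1 : ∑' n : ℕ, (conj w.1.2 • coordTwo) ^ n = szego (dropOne w) := by
    ext ζ
    have h2 := congrArg (· ζ) (geom_series_mul_neg _ hn)
    have h3 := one_sub_mul_conj_ne_zero ζ.2 w.2.2
    simp only [ContinuousMap.mul_apply, ContinuousMap.sub_apply, ContinuousMap.one_apply,
      ContinuousMap.smul_apply, smul_eq_mul, coordTwo_apply] at h2
    have h4 : szego (dropOne w) ζ = 1 / (1 - (ζ.2 : ℂ) * conj w.1.2) := by simp [szego_apply, dropOne]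
    rw [h4, eq_div_iff h3]
    linear_combination h2
  rw [h1] at h
  refine (funext fun n => ?_ : (fun n : ℕ => _) = _) ▸ h
  ext ζ
  simp [monomial, mul_pow]

theorem hasSum_szego_dropTwo (w : bidisk) :
    HasSum (fun n : ℕ => conj w.1.1 ^ n • monomial n 0) (szego (dropTwo w)) := by
  have hn : ‖conj w.1.1 • coordOne‖ < 1 :=
    norm_smul_coordOne_lt_one (by simpa using w.2.1)
  have h := (summable_geometric_of_norm_lt_one hn).hasSum
  have h1 : ∑' n : ℕ, (conj w.1.1 • coordOne) ^ n = szego (dropTwo w) := by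
    ext ζ
    have h2 := congrArg (· ζ) (geom_series_mul_neg _ hn)
    have h3 := one_sub_mul_conj_ne_zero ζ.1 w.2.1
    simp only [ContinuousMap.mul_apply, ContinuousMap.sub_apply, ContinuousMap.one_apply,
      ContinuousMap.smul_apply, smul_eq_mul, coordOne_apply] at h2
    have h4 : szego (dropTwo w) ζ = 1 / (1 - (ζ.1 : ℂ) * conj w.1.1) := by simp [szego_apply, dropTwo]
    rw [h4, eq_div_iff h3]
    linear_combination h2
  rw [h1] at h
  refine (funext fun n => ?_ : (fun n : ℕ => _) = _) ▸ h
  ext ζ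
  simp [monomial, mul_pow]

/-! ### The Hardy space -/

theorem mem_hardy_iff {g : L2 torusMeasure} :
    g ∈ hardy ↔ ∀ m n : ℤ, (m < 0 ∨ n < 0) → ⟪toL2 torusMeasure (monomial m n), g⟫_ℂ = 0 := by
  rw [hardy, Submodule.mem_orthogonal]
  refine ⟨fun h m n hmn => h _ (Submodule.subset_span ⟨m, n, hmn, rfl⟩), fun h u hu => ?_⟩
  refine Submodule.span_induction (p := fun u _ => ⟪u, g⟫_ℂ = 0) ?_ (inner_zero_left _) ?_ ?_ hu
  · rintro - ⟨m, n, hmn, rfl⟩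
    exact h m n hmn
  · intro x y _ _ hx hy
    rw [inner_add_left, hx, hy, add_zero]
  · intro c x _ hx
    rw [inner_smul_left, hx, mul_zero]

theorem isClosed_hardy : IsClosed (hardy : Set (L2 torusMeasure)) :=
  Submodule.isClosed_orthogonal _

theorem inner_monomial_monomial {m n k l : ℤ} (h : m ≠ k ∨ n ≠ l) :
    ⟪toL2 torusMeasure (monomial m n), toL2 torusMeasure (monomial k l)⟫_ℂ = 0 := by
  rw [inner_toL2_toL2]
  have : ∀ ζ, monomial k l ζ * conj (monomial m n ζ) = monomial (k - m) (l - n) ζ := fun ζ => by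
    rw [← RCLike.star_def, ← ContinuousMap.star_apply, ← ContinuousMap.mul_apply, star_monomial,
      monomial_mul, sub_eq_add_neg, sub_eq_add_neg]
  simp_rw [this]
  exact integral_monomial (by omega)

theorem monomial_mem_hardy (m n : ℕ) : toL2 torusMeasure (monomial m n) ∈ hardy :=
  mem_hardy_iff.2 fun _ _ h => inner_monomial_monomial (by omega)

theorem mem_hardy_orthogonal {m n : ℤ} (h : m < 0 ∨ n < 0) :
    toL2 torusMeasure (monomial m n) ∈ hardyᗮ :=
  Submodule.le_orthogonal_orthogonal _ (Submodule.subset_span ⟨m, n, h, rfl⟩)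

/-- The closed span of the monomials with nonnegative exponents. -/
def analyticSpan : Submodule ℂ (L2 torusMeasure) :=
  (Submodule.span ℂ
    {e | ∃ m n : ℕ, e = toL2 torusMeasure (monomial m n)}).topologicalClosure

instance : CompleteSpace analyticSpan :=
  (Submodule.isClosed_topologicalClosure _).completeSpace_coe

theorem analyticSpan_le {S : Submodule ℂ (L2 torusMeasure)}
    (hS : IsClosed (S : Set (L2 torusMeasure)))
    (h : ∀ m n : ℕ, toL2 torusMeasure (monomial m n) ∈ S) : analyticSpan ≤ S := by
  refine Submodule.topologicalClosure_minimal _ (Submodule.span_le.2 ?_) hS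
  rintro - ⟨m, n, rfl⟩
  exact h m n

/-- For `g` in the Hardy space and `P` the projection onto the closed span, `g - P g` has zero
Fourier coefficients at exponents with a negative entry (it lies in the Hardy space) and at the
others (it is orthogonal to the span). -/
theorem hardy_eq_analyticSpan : hardy = analyticSpan := by
  refine le_antisymm (fun g hg => ?_) (analyticSpan_le isClosed_hardy monomial_mem_hardy)
  have hP : analyticSpan.starProjection g ∈ analyticSpan := Submodule.starProjection_apply_mem _ g
  have h1 : g - analyticSpan.starProjection g ∈ hardy :=
    hardy.sub_mem hg (analyticSpan_le isClosed_hardy monomial_mem_hardy hP)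
  have h2 : g - analyticSpan.starProjection g ∈ analyticSpanᗮ :=
    Submodule.sub_starProjection_mem_orthogonal g
  have h3 : g - analyticSpan.starProjection g = 0 := by
    refine eq_zero_of_inner_monomial fun m n => ?_
    by_cases hmn : m < 0 ∨ n < 0
    · exact mem_hardy_iff.1 h1 m n hmn
    · push Not at hmn
      lift m to ℕ using hmn.1
      lift n to ℕ using hmn.2
      exact h2 _ (Submodule.le_topologicalClosure _ (Submodule.subset_span ⟨m, n, rfl⟩))
  rw [sub_eq_zero.1 h3]
  exact hP

theorem hardy_le {S : Submodule ℂ (L2 torusMeasure)}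
    (hS : IsClosed (S : Set (L2 torusMeasure)))
    (h : ∀ m n : ℕ, toL2 torusMeasure (monomial m n) ∈ S) : hardy ≤ S :=
  hardy_eq_analyticSpan ▸ analyticSpan_le hS h

theorem _root_.Submodule.mem_of_hasSum {E ι : Type*} [AddCommGroup E] [TopologicalSpace E]
    [Module ℂ E] {S : Submodule ℂ E} (hS : IsClosed (S : Set E)) {f : ι → E} {a : E}
    (h : HasSum f a) (hf : ∀ i, f i ∈ S) : a ∈ S :=
  hS.mem_of_tendsto h (.of_forall fun _ => S.sum_mem fun i _ => hf i)

theorem isClosed_comap_toL2 {S : Submodule ℂ (L2 torusMeasure)}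
    (hS : IsClosed (S : Set (L2 torusMeasure))) :
    IsClosed (S.comap (ContinuousMap.toLp (E := ℂ) 2 torusMeasure ℂ).toLinearMap :
      Set C(Torus, ℂ)) :=
  hS.preimage (ContinuousMap.toLp (E := ℂ) 2 torusMeasure ℂ).continuous

/-- A closed subspace contains `g k_w`, where `k_w` depends on the second variable alone, as soon
as it contains all products of `g` with powers of the second coordinate. -/
theorem toL2_mul_szego_dropOne_mem {S : Submodule ℂ (L2 torusMeasure)}
    (hS : IsClosed (S : Set (L2 torusMeasure))) (g : C(Torus, ℂ))
    (h : ∀ n : ℕ, toL2 torusMeasure (g * monomial 0 n) ∈ S) (w : bidisk) :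
    toL2 torusMeasure (g * szego (dropOne w)) ∈ S := by
  refine Submodule.mem_of_hasSum (isClosed_comap_toL2 hS) ((hasSum_szego_dropOne w).mul_left g)
    fun n => ?_
  rw [mul_smul_comm]
  exact Submodule.smul_mem _ _ (h n)

theorem toL2_mul_szego_dropTwo_mem {S : Submodule ℂ (L2 torusMeasure)}
    (hS : IsClosed (S : Set (L2 torusMeasure))) (g : C(Torus, ℂ))
    (h : ∀ n : ℕ, toL2 torusMeasure (g * monomial n 0) ∈ S) (w : bidisk) :
    toL2 torusMeasure (g * szego (dropTwo w)) ∈ S := by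
  refine Submodule.mem_of_hasSum (isClosed_comap_toL2 hS) ((hasSum_szego_dropTwo w).mul_left g)
    fun n => ?_
  rw [mul_smul_comm]
  exact Submodule.smul_mem _ _ (h n)

theorem szego_eq_mul (w : bidisk) : szego w = szego (dropOne w) * szego (dropTwo w) := by
  ext ζ
  rw [ContinuousMap.mul_apply]
  simp only [szego_apply, dropOne, dropTwo, map_zero, mul_zero, sub_zero, one_mul, mul_one]
  rw [one_div_mul_one_div, mul_comm]

theorem szego_mem_hardy (w : bidisk) : toL2 torusMeasure (szego w) ∈ hardy := by
  rw [szego_eq_mul]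
  refine toL2_mul_szego_dropTwo_mem isClosed_hardy _ (fun m => ?_) w
  rw [mul_comm]
  refine toL2_mul_szego_dropOne_mem isClosed_hardy _ (fun n => ?_) w
  rw [monomial_mul, add_zero, zero_add]
  exact monomial_mem_hardy m n

theorem star_coordOne_mul_szego_dropOne_mem (w : bidisk) :
    toL2 torusMeasure (star coordOne * szego (dropOne w)) ∈ hardyᗮ := by
  refine toL2_mul_szego_dropOne_mem (Submodule.isClosed_orthogonal _) _ (fun n => ?_) w
  rw [star_coordOne_mul_monomial]
  exact mem_hardy_orthogonal (by simp)

theorem star_coordTwo_mul_szego_dropTwo_mem (w : bidisk) :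
    toL2 torusMeasure (star coordTwo * szego (dropTwo w)) ∈ hardyᗮ := by
  refine toL2_mul_szego_dropTwo_mem (Submodule.isClosed_orthogonal _) _ (fun n => ?_) w
  rw [star_coordTwo_mul_monomial]
  exact mem_hardy_orthogonal (by simp)

/-- The value at `z` of the Cauchy integral of `g`. -/
abbrev cauchyEval (z : bidisk) (g : L2 torusMeasure) : ℂ := ⟪toL2 torusMeasure (szego z), g⟫_ℂ

theorem coordOne_mul_mem_hardy {g : L2 torusMeasure} (hg : g ∈ hardy) :
    mulOp torusMeasure coordOne g ∈ hardy := by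
  refine mem_hardy_iff.2 fun m n h => ?_
  rw [inner_toL2_mulOp, star_coordOne_mul_monomial]
  exact mem_hardy_iff.1 hg _ _ (by omega)

theorem coordTwo_mul_mem_hardy {g : L2 torusMeasure} (hg : g ∈ hardy) :
    mulOp torusMeasure coordTwo g ∈ hardy := by
  refine mem_hardy_iff.2 fun m n h => ?_
  rw [inner_toL2_mulOp, star_coordTwo_mul_monomial]
  exact mem_hardy_iff.1 hg _ _ (by omega)

/-- Moving `z₁` to the kernel side gives `conj ζ₁ k_z`, which equals `conj z₁ k_z` up to a vector
orthogonal to `H²`. -/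
theorem cauchyEval_coordOne_mul {g : L2 torusMeasure} (hg : g ∈ hardy) (z : bidisk) :
    cauchyEval z (mulOp torusMeasure coordOne g) = z.1.1 * cauchyEval z g := by
  rw [cauchyEval, inner_toL2_mulOp, star_coordOne_mul_szego, toL2_add, toL2_smul, inner_add_left,
    inner_smul_left, Submodule.inner_left_of_mem_orthogonal hg
      (star_coordOne_mul_szego_dropOne_mem z), add_zero, Complex.conj_conj]

theorem cauchyEval_coordTwo_mul {g : L2 torusMeasure} (hg : g ∈ hardy) (z : bidisk) :
    cauchyEval z (mulOp torusMeasure coordTwo g) = z.1.2 * cauchyEval z g := by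
  rw [cauchyEval, inner_toL2_mulOp, star_coordTwo_mul_szego, toL2_add, toL2_smul, inner_add_left,
    inner_smul_left, Submodule.inner_left_of_mem_orthogonal hg
      (star_coordTwo_mul_szego_dropTwo_mem z), add_zero, Complex.conj_conj]

theorem continuous_cauchyEval (g : L2 torusMeasure) : Continuous fun z => cauchyEval z g := by
  refine Continuous.inner ?_ continuous_const
  exact (ContinuousMap.toLp (E := ℂ) 2 torusMeasure ℂ).continuous.comp continuous_szego

theorem szego_zero : szego ⟨(0, 0), by simp [bidisk]⟩ = 1 := by
  ext ζ
  simp [szego_apply]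

/-- Setting one coordinate of `w` to zero changes `k_w` by a multiple of that coordinate function
times an element of `H²`, which has no constant term. Doing this twice reduces to `k_0 = 1`. -/
theorem inner_one_szego (z : bidisk) :
    ⟪toL2 torusMeasure 1, toL2 torusMeasure (szego z)⟫_ℂ = 1 := by
  have key1 : ∀ w : bidisk, ⟪toL2 torusMeasure 1, toL2 torusMeasure (szego w)⟫_ℂ =
      ⟪toL2 torusMeasure 1, toL2 torusMeasure (szego (dropOne w))⟫_ℂ := fun w => by
    have h := congrArg (toL2 torusMeasure) (conj_smul_coordOne_mul_szego w)
    rw [toL2_smul, toL2_sub] at h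
    rw [← sub_eq_zero, ← inner_sub_right, ← h, inner_smul_right, ← mulOp_toL2, inner_toL2_mulOp,
      ← monomial_zero_zero, star_coordOne_mul_monomial,
      mem_hardy_iff.1 (szego_mem_hardy w) _ _ (by simp), mul_zero]
  have key2 : ∀ w : bidisk, ⟪toL2 torusMeasure 1, toL2 torusMeasure (szego w)⟫_ℂ =
      ⟪toL2 torusMeasure 1, toL2 torusMeasure (szego (dropTwo w))⟫_ℂ := fun w => by
    have h := congrArg (toL2 torusMeasure) (conj_smul_coordTwo_mul_szego w)
    rw [toL2_smul, toL2_sub] at h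
    rw [← sub_eq_zero, ← inner_sub_right, ← h, inner_smul_right, ← mulOp_toL2, inner_toL2_mulOp,
      ← monomial_zero_zero, star_coordTwo_mul_monomial,
      mem_hardy_iff.1 (szego_mem_hardy w) _ _ (by simp), mul_zero]
  have h0 : szego (dropTwo (dropOne z)) = 1 := szego_zero
  rw [key1, key2, h0, inner_toL2_toL2]
  simp

theorem cauchyEval_one (z : bidisk) : cauchyEval z (toL2 torusMeasure 1) = 1 := by
  rw [cauchyEval, ← inner_conj_symm, inner_one_szego, map_one]

theorem one_sub_mul_ne_zero_of_norm_lt {a b : ℂ} (ha : ‖a‖ < 1) (hb : ‖b‖ < 1) :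
    1 - a * conj b ≠ 0 := by
  intro h
  have h1 : ‖a * conj b‖ = 1 := by rw [← sub_eq_zero.1 h]; simp
  rw [norm_mul, RCLike.norm_conj] at h1
  nlinarith [norm_nonneg a, norm_nonneg b]

/-- The reproducing property, for the Szegő kernels themselves. -/
theorem cauchyEval_szego (z w : bidisk) :
    cauchyEval z (toL2 torusMeasure (szego w)) =
      1 / ((1 - z.1.1 * conj w.1.1) * (1 - z.1.2 * conj w.1.2)) := by
  have h1 : ∀ w : bidisk, (1 - z.1.1 * conj w.1.1) * cauchyEval z (toL2 torusMeasure (szego w)) =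
      cauchyEval z (toL2 torusMeasure (szego (dropOne w))) := fun w => by
    have h := congrArg (toL2 torusMeasure) (conj_smul_coordOne_mul_szego w)
    rw [toL2_smul, toL2_sub, ← mulOp_toL2] at h
    have h2 := congrArg (cauchyEval z) h
    rw [cauchyEval, inner_smul_right, cauchyEval, inner_sub_right] at h2
    have h3 := cauchyEval_coordOne_mul (szego_mem_hardy w) z
    rw [cauchyEval] at h3
    rw [h3] at h2
    linear_combination -h2
  have h1' : ∀ w : bidisk, (1 - z.1.2 * conj w.1.2) * cauchyEval z (toL2 torusMeasure (szego w)) =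
      cauchyEval z (toL2 torusMeasure (szego (dropTwo w))) := fun w => by
    have h := congrArg (toL2 torusMeasure) (conj_smul_coordTwo_mul_szego w)
    rw [toL2_smul, toL2_sub, ← mulOp_toL2] at h
    have h2 := congrArg (cauchyEval z) h
    rw [cauchyEval, inner_smul_right, cauchyEval, inner_sub_right] at h2
    have h3 := cauchyEval_coordTwo_mul (szego_mem_hardy w) z
    rw [cauchyEval] at h3
    rw [h3] at h2
    linear_combination -h2
  have h0 : szego (dropTwo (dropOne w)) = 1 := szego_zero
  have h2 := h1 w
  have h3 := h1' (dropOne w)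
  rw [h0, cauchyEval_one, ← h2] at h3
  rw [eq_div_iff (mul_ne_zero (one_sub_mul_ne_zero_of_norm_lt z.2.1 w.2.1)
    (one_sub_mul_ne_zero_of_norm_lt z.2.2 w.2.2))]
  simp only [dropOne] at h3
  linear_combination h3

/-- Lets identities obtained after division by `w₁` be extended to `w₁ = 0` by continuity. -/
theorem dense_fst_ne_zero : Dense {w : bidisk | w.1.1 ≠ 0} :=
  (dense_compl_singleton (0 : ℂ)).preimage
    (isOpenMap_fst.comp isOpen_bidisk.isOpenMap_subtype_val)

theorem dense_snd_ne_zero : Dense {w : bidisk | w.1.2 ≠ 0} :=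
  (dense_compl_singleton (0 : ℂ)).preimage
    (isOpenMap_snd.comp isOpen_bidisk.isOpenMap_subtype_val)

/-- The closed span of the Szegő kernels, in the space of continuous functions. -/
def szegoSpan : Submodule ℂ C(Torus, ℂ) := (Submodule.span ℂ (range szego)).topologicalClosure

theorem szego_mem_szegoSpan (w : bidisk) : szego w ∈ szegoSpan :=
  Submodule.le_topologicalClosure _ (Submodule.subset_span ⟨w, rfl⟩)

theorem isClosed_szegoSpan : IsClosed (szegoSpan : Set C(Torus, ℂ)) :=
  Submodule.isClosed_topologicalClosure _

/-- For `w₁ ≠ 0` the product `ζ₁ k_w` is a multiple of `k_w - k_(0,w₂)`; the case `w₁ = 0` follows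
by continuity in `w`. -/
theorem coordOne_mul_mem_szegoSpan {g : C(Torus, ℂ)} (hg : g ∈ szegoSpan) :
    coordOne * g ∈ szegoSpan := by
  have h1 : ∀ w : bidisk, coordOne * szego w ∈ szegoSpan := by
    have hc : IsClosed {w : bidisk | coordOne * szego w ∈ szegoSpan} :=
      isClosed_szegoSpan.preimage (continuous_const.mul continuous_szego)
    refine fun w => hc.closure_subset_iff.2 (fun w hw => ?_) (dense_fst_ne_zero w)
    have hw' : conj w.1.1 ≠ 0 := (map_ne_zero _).2 hw
    change coordOne * szego w ∈ szegoSpan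
    rw [← inv_smul_smul₀ hw' (coordOne * szego w), conj_smul_coordOne_mul_szego]
    exact Submodule.smul_mem _ _
      (Submodule.sub_mem _ (szego_mem_szegoSpan _) (szego_mem_szegoSpan _))
  have h2 : szegoSpan ≤ szegoSpan.comap (LinearMap.mulLeft ℂ coordOne) := by
    refine Submodule.topologicalClosure_minimal _ (Submodule.span_le.2 ?_)
      (isClosed_szegoSpan.preimage (continuous_const.mul continuous_id))
    rintro - ⟨w, rfl⟩
    exact h1 w
  exact h2 hg

theorem coordTwo_mul_mem_szegoSpan {g : C(Torus, ℂ)} (hg : g ∈ szegoSpan) :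
    coordTwo * g ∈ szegoSpan := by
  have h1 : ∀ w : bidisk, coordTwo * szego w ∈ szegoSpan := by
    have hc : IsClosed {w : bidisk | coordTwo * szego w ∈ szegoSpan} :=
      isClosed_szegoSpan.preimage (continuous_const.mul continuous_szego)
    refine fun w => hc.closure_subset_iff.2 (fun w hw => ?_) (dense_snd_ne_zero w)
    have hw' : conj w.1.2 ≠ 0 := (map_ne_zero _).2 hw
    change coordTwo * szego w ∈ szegoSpan
    rw [← inv_smul_smul₀ hw' (coordTwo * szego w), conj_smul_coordTwo_mul_szego]
    exact Submodule.smul_mem _ _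
      (Submodule.sub_mem _ (szego_mem_szegoSpan _) (szego_mem_szegoSpan _))
  have h2 : szegoSpan ≤ szegoSpan.comap (LinearMap.mulLeft ℂ coordTwo) := by
    refine Submodule.topologicalClosure_minimal _ (Submodule.span_le.2 ?_)
      (isClosed_szegoSpan.preimage (continuous_const.mul continuous_id))
    rintro - ⟨w, rfl⟩
    exact h1 w
  exact h2 hg

theorem monomial_mem_szegoSpan (m n : ℕ) : monomial m n ∈ szegoSpan := by
  induction m with
  | zero =>
    induction n with
    | zero =>
      have h := szego_mem_szegoSpan ⟨(0, 0), by simp [bidisk]⟩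
      rw [szego_zero] at h
      simpa using h
    | succ n ih =>
      have h := coordTwo_mul_mem_szegoSpan ih
      rw [coordTwo_mul_monomial] at h
      exact_mod_cast h
  | succ m ih =>
    have h := coordOne_mul_mem_szegoSpan ih
    rw [coordOne_mul_monomial] at h
    exact_mod_cast h

/-- An element of the Hardy space is determined by its Cauchy integral off `z₁ = 0`. -/
theorem eq_zero_of_cauchyEval {g : L2 torusMeasure} (hg : g ∈ hardy)
    (h : ∀ z : bidisk, z.1.1 ≠ 0 → cauchyEval z g = 0) : g = 0 := by
  have h0 : ∀ z : bidisk, cauchyEval z g = 0 := by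
    have hc : IsClosed {z : bidisk | cauchyEval z g = 0} :=
      isClosed_eq (continuous_cauchyEval g) continuous_const
    exact fun z => hc.closure_subset_iff.2 (fun z hz => h z hz) (dense_fst_ne_zero z)
  have h1 : szegoSpan ≤
      ((ℂ ∙ g)ᗮ).comap (ContinuousMap.toLp (E := ℂ) 2 torusMeasure ℂ).toLinearMap := by
    refine Submodule.topologicalClosure_minimal _ (Submodule.span_le.2 ?_)
      (isClosed_comap_toL2 (Submodule.isClosed_orthogonal _))
    rintro - ⟨w, rfl⟩
    exact Submodule.mem_orthogonal_singleton_iff_inner_left.2 (h0 w)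
  have h2 : hardy ≤ (ℂ ∙ g)ᗮ :=
    hardy_le (Submodule.isClosed_orthogonal _) fun m n => h1 (monomial_mem_szegoSpan m n)
  exact inner_self_eq_zero.1 (Submodule.mem_orthogonal_singleton_iff_inner_left.1 (h2 hg))

theorem eq_of_cauchyEval {f g : L2 torusMeasure} (hf : f ∈ hardy) (hg : g ∈ hardy)
    (h : ∀ z : bidisk, z.1.1 ≠ 0 → cauchyEval z f = cauchyEval z g) : f = g :=
  sub_eq_zero.1 <| eq_zero_of_cauchyEval (hardy.sub_mem hf hg) fun z hz => by
    rw [cauchyEval, inner_sub_right, sub_eq_zero]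
    exact h z hz

/-- Multiplication by bounded elements preserves the Hardy space and is multiplicative on Cauchy
integrals. -/
theorem mulOp_mem_hardy_and_cauchyEval {b g : L2 torusMeasure} (hb : b ∈ hardy)
    (hb' : MemLp b ∞ torusMeasure) (hg : g ∈ hardy) :
    mulOp torusMeasure b g ∈ hardy ∧
      ∀ z, cauchyEval z (mulOp torusMeasure b g) = cauchyEval z b * cauchyEval z g := by
  -- The `g` for which the claim holds form a closed subspace; it contains `1` and is stable under
  -- both coordinates, so it contains all of `H²`. Membership `g ∈ hardy` is part of `S` because the
  -- stability step evaluates Cauchy integrals of `z_j g`.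
  let S : Submodule ℂ (L2 torusMeasure) :=
    hardy.comap (mulOp torusMeasure b).toLinearMap ⊓ hardy ⊓ ⨅ z : bidisk,
      ((innerSL ℂ (toL2 torusMeasure (szego z)) ∘L mulOp torusMeasure b -
        cauchyEval z b • innerSL ℂ (toL2 torusMeasure (szego z))).ker)
  have hS : ∀ g, g ∈ S ↔ (mulOp torusMeasure b g ∈ hardy ∧ g ∈ hardy) ∧
      ∀ z, cauchyEval z (mulOp torusMeasure b g) = cauchyEval z b * cauchyEval z g := fun g => by
    simp [S, sub_eq_zero]
  have hc : IsClosed (S : Set (L2 torusMeasure)) := by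
    simp only [S, Submodule.coe_inf, Submodule.coe_iInf]
    refine ((isClosed_hardy.preimage (mulOp torusMeasure b).continuous).inter
      isClosed_hardy).inter (isClosed_iInter fun z => ?_)
    exact ContinuousLinearMap.isClosed_ker _
  have hone : toL2 torusMeasure (monomial 0 0) ∈ S := by
    have h1 : mulOp torusMeasure b (toL2 torusMeasure 1) = b := by
      refine Lp.ext ?_
      filter_upwards [mulOp_ae hb' (toL2 torusMeasure 1), toL2_ae (μ := torusMeasure) 1]
        with ζ h1 h2
      rw [h1, h2, ContinuousMap.one_apply, mul_one]
    refine (hS _).2 ⟨⟨?_, monomial_mem_hardy 0 0⟩, fun z => ?_⟩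
    · rwa [monomial_zero_zero, h1]
    · rw [monomial_zero_zero, h1, cauchyEval_one, mul_one]
  have hstepOne : ∀ m n : ℤ, toL2 torusMeasure (monomial m n) ∈ S →
      toL2 torusMeasure (monomial (m + 1) n) ∈ S := fun m n h => by
    obtain ⟨⟨h1, h2⟩, h3⟩ := (hS _).1 h
    rw [← coordOne_mul_monomial, ← mulOp_toL2, hS,
      mulOp_comm hb' (memLp_top_continuousMap coordOne)]
    refine ⟨⟨coordOne_mul_mem_hardy h1, coordOne_mul_mem_hardy h2⟩, fun z => ?_⟩
    rw [cauchyEval_coordOne_mul h1, cauchyEval_coordOne_mul h2, h3]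
    ring
  have hstepTwo : ∀ m n : ℤ, toL2 torusMeasure (monomial m n) ∈ S →
      toL2 torusMeasure (monomial m (n + 1)) ∈ S := fun m n h => by
    obtain ⟨⟨h1, h2⟩, h3⟩ := (hS _).1 h
    rw [← coordTwo_mul_monomial, ← mulOp_toL2, hS,
      mulOp_comm hb' (memLp_top_continuousMap coordTwo)]
    refine ⟨⟨coordTwo_mul_mem_hardy h1, coordTwo_mul_mem_hardy h2⟩, fun z => ?_⟩
    rw [cauchyEval_coordTwo_mul h1, cauchyEval_coordTwo_mul h2, h3]
    ring
  have hle : hardy ≤ S := hardy_le hc fun m n => by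
    induction m with
    | zero =>
      induction n with
      | zero => exact hone
      | succ n ih => exact_mod_cast hstepTwo _ _ ih
    | succ m ih => exact_mod_cast hstepOne _ _ ih
  obtain ⟨⟨h1, -⟩, h3⟩ := (hS _).1 (hle hg)
  exact ⟨h1, h3⟩

/-! ### The Hardy space in the second variable -/

theorem monomial_mem_hardyTwo (n : ℕ) : toL2 torusMeasure (monomial 0 n) ∈ hardyTwo :=
  Submodule.le_topologicalClosure _ (Submodule.subset_span ⟨n, rfl⟩)

theorem hardyTwo_le {S : Submodule ℂ (L2 torusMeasure)}
    (hS : IsClosed (S : Set (L2 torusMeasure)))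
    (h : ∀ n : ℕ, toL2 torusMeasure (monomial 0 n) ∈ S) : hardyTwo ≤ S := by
  refine Submodule.topologicalClosure_minimal _ (Submodule.span_le.2 ?_) hS
  rintro - ⟨n, rfl⟩
  exact h n

theorem hardyTwo_le_hardy : hardyTwo ≤ hardy :=
  hardyTwo_le isClosed_hardy fun n => by simpa using monomial_mem_hardy 0 n

theorem szego_dropOne_mem_hardyTwo (w : bidisk) :
    toL2 torusMeasure (szego (dropOne w)) ∈ hardyTwo := by
  have h := toL2_mul_szego_dropOne_mem (Submodule.isClosed_topologicalClosure _) 1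
    (fun n => by rw [one_mul]; exact monomial_mem_hardyTwo n) w
  rwa [one_mul] at h

theorem star_coordOne_mul_mem_orthogonal {g : L2 torusMeasure} (hg : g ∈ hardyTwo) :
    mulOp torusMeasure (fun ζ => conj (coordOne ζ)) g ∈ hardyᗮ := by
  have h : hardyTwo ≤ (hardyᗮ).comap
      (mulOp torusMeasure (star coordOne : C(Torus, ℂ))).toLinearMap := by
    refine hardyTwo_le ((Submodule.isClosed_orthogonal _).preimage
      (mulOp torusMeasure (star coordOne : C(Torus, ℂ))).continuous) fun n => ?_
    rw [Submodule.mem_comap]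
    change mulOp torusMeasure (star coordOne : C(Torus, ℂ)) _ ∈ _
    rw [mulOp_toL2, star_coordOne_mul_monomial]
    exact mem_hardy_orthogonal (by simp)
  exact h hg

/-- The difference `k_w - k_(0,w₂)` is a multiple of `ζ₁ k_w`, and `ζ₁ H²` is orthogonal to the
functions of `z₂` alone. -/
theorem starProjection_hardyTwo_szego (w : bidisk) :
    hardyTwo.starProjection (toL2 torusMeasure (szego w)) =
      toL2 torusMeasure (szego (dropOne w)) := by
  refine Submodule.eq_starProjection_of_mem_orthogonal (szego_dropOne_mem_hardyTwo w) ?_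
  rw [← toL2_sub, ← conj_smul_coordOne_mul_szego, toL2_smul]
  refine Submodule.smul_mem _ _ ((Submodule.mem_orthogonal' _ _).2 fun u hu => ?_)
  rw [← mulOp_toL2, inner_mulOp_left (memLp_top_continuousMap coordOne)]
  exact Submodule.inner_right_of_mem_orthogonal (szego_mem_hardy w)
    (star_coordOne_mul_mem_orthogonal hu)

theorem cauchyEval_starProjection_hardyTwo (z : bidisk) (g : L2 torusMeasure) :
    cauchyEval z (hardyTwo.starProjection g) = cauchyEval (dropOne z) g := by
  rw [cauchyEval, ← Submodule.inner_starProjection_left_eq_right, starProjection_hardyTwo_szego]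

/-! ### Boundary functions -/

theorem isBoundaryFunction_iff {f : ℂ × ℂ → ℂ} {b : L2 torusMeasure} :
    IsBoundaryFunction f b ↔ b ∈ hardy ∧ ∀ z : bidisk, f z = cauchyEval z b := by
  simp only [IsBoundaryFunction, cauchyEval, inner_toL2]

/-- Cauchy integrals determine elements of `H²`, so the choice in the definition of
`boundaryFunction` is immaterial. -/
theorem IsBoundaryFunction.eq_boundaryFunction {f : ℂ × ℂ → ℂ} {b : L2 torusMeasure}
    (h : IsBoundaryFunction f b) : boundaryFunction f = b := by
  have h1 : ∃ b, IsBoundaryFunction f b := ⟨b, h⟩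
  have h2 : IsBoundaryFunction f (boundaryFunction f) := by
    rw [boundaryFunction, dif_pos h1]
    exact h1.choose_spec
  rw [isBoundaryFunction_iff] at h h2
  exact eq_of_cauchyEval h2.1 h.1 fun z _ => by rw [← h.2, ← h2.2]

/-- Functions on the bidisk that are holomorphic in each variable, possibly with the exception of
holomorphy in the second variable on `z₁ = 0`. -/
structure SliceHolomorphic (f : ℂ × ℂ → ℂ) : Prop where
  continuousOn : ContinuousOn f {z | z ∈ bidisk ∧ z.1 ≠ 0}
  left : ∀ t : ℂ, ‖t‖ < 1 → DifferentiableOn ℂ (fun s => f (s, t)) (Metric.ball 0 1)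
  right : ∀ s : ℂ, s ≠ 0 → ‖s‖ < 1 → DifferentiableOn ℂ (fun t => f (s, t)) (Metric.ball 0 1)

theorem sliceHolomorphic_of_differentiableOn {f : ℂ × ℂ → ℂ} (hf : DifferentiableOn ℂ f bidisk) :
    SliceHolomorphic f where
  continuousOn := hf.continuousOn.mono fun _ h => h.1
  left t ht := hf.comp (f := fun s => (s, t)) (by fun_prop) fun s hs =>
    ⟨by simpa using hs, ht⟩
  right s _ hs := hf.comp (f := fun t => (s, t)) (by fun_prop) fun t ht =>
    ⟨hs, by simpa using ht⟩

theorem integrable_continuousMap {μ : Measure Torus} [IsFiniteMeasure μ] (g : C(Torus, ℂ)) :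
    Integrable g μ :=
  (memLp_top_continuousMap g).integrable le_top

theorem norm_ofReal_mul_circle {r : ℝ} (hr : 0 < r) (ζ : Circle) : ‖(r : ℂ) * ζ‖ = r := by
  rw [norm_mul, Circle.norm_coe, mul_one, Complex.norm_real, Real.norm_of_nonneg hr.le]

theorem ofReal_mul_mem_bidisk {r : ℝ} (hr : 0 < r) (hr1 : r < 1) (ζ : Torus) :
    ((r : ℂ) * ζ.1, (r : ℂ) * ζ.2) ∈ bidisk :=
  ⟨by rw [norm_ofReal_mul_circle hr]; exact hr1, by rw [norm_ofReal_mul_circle hr]; exact hr1⟩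

/-- The dilated torus `|z₁| = |z₂| = r` stays away from `z₁ = 0`, so continuity there is not needed.
-/
theorem SliceHolomorphic.exists_dilation {f : ℂ × ℂ → ℂ} (hf : SliceHolomorphic f) {r : ℝ}
    (hr : 0 < r) (hr1 : r < 1) :
    ∃ F : C(Torus, ℂ), ∀ ζ : Torus, F ζ = f ((r : ℂ) * ζ.1, (r : ℂ) * ζ.2) := by
  refine ⟨⟨fun ζ => f ((r : ℂ) * ζ.1, (r : ℂ) * ζ.2), ?_⟩, fun ζ => rfl⟩
  refine hf.continuousOn.comp_continuous (by fun_prop) fun ζ =>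
    ⟨ofReal_mul_mem_bidisk hr hr1 ζ, ?_⟩
  refine norm_ne_zero_iff.1 ?_
  change ‖(r : ℂ) * ζ.1‖ ≠ 0
  rw [norm_ofReal_mul_circle hr]
  exact hr.ne'

theorem differentiableOn_dilation {g : ℂ → ℂ} (hg : DifferentiableOn ℂ g (Metric.ball 0 1)) {r : ℝ}
    (hr : 0 < r) : DifferentiableOn ℂ (fun s => g ((r : ℂ) * s)) (Metric.ball 0 r⁻¹) := by
  refine hg.comp (by fun_prop) fun s hs => ?_
  rw [mem_ball_zero_iff] at hs ⊢
  rw [norm_mul, Complex.norm_real, Real.norm_of_nonneg hr.le]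
  calc r * ‖s‖ < r * r⁻¹ := by gcongr
    _ = 1 := mul_inv_cancel₀ hr.ne'

theorem differentiableOn_dilation_left {f : ℂ × ℂ → ℂ} (hf : SliceHolomorphic f) {r : ℝ}
    (hr : 0 < r) (hr1 : r < 1) {t : ℂ} (ht : ‖t‖ ≤ 1) :
    DifferentiableOn ℂ (fun s => f ((r : ℂ) * s, (r : ℂ) * t)) (Metric.ball 0 r⁻¹) := by
  refine differentiableOn_dilation (hf.left _ ?_) hr
  rw [norm_mul, Complex.norm_real, Real.norm_of_nonneg hr.le]
  exact (mul_le_of_le_one_right hr.le ht).trans_lt hr1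

theorem differentiableOn_dilation_right {f : ℂ × ℂ → ℂ} (hf : SliceHolomorphic f) {r : ℝ}
    (hr : 0 < r) (hr1 : r < 1) (ζ : Circle) :
    DifferentiableOn ℂ (fun t => f ((r : ℂ) * ζ, (r : ℂ) * t)) (Metric.ball 0 r⁻¹) := by
  refine differentiableOn_dilation (hf.right _ (norm_ne_zero_iff.1 ?_) ?_) hr <;>
    rw [norm_ofReal_mul_circle hr]
  exacts [hr.ne', hr1]

theorem integral_torusMeasure (g : C(Torus, ℂ)) :
    ∫ ζ, g ζ ∂torusMeasure = ∫ x, ∫ y, g (x, y) ∂circleMeasure ∂circleMeasure :=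
  integral_prod _ (integrable_continuousMap g)

theorem integral_torusMeasure_symm (g : C(Torus, ℂ)) :
    ∫ ζ, g ζ ∂torusMeasure = ∫ y, ∫ x, g (x, y) ∂circleMeasure ∂circleMeasure :=
  integral_prod_symm _ (integrable_continuousMap g)

theorem inner_toL2_toL2_eq_integral (g h : C(Torus, ℂ)) :
    ⟪toL2 torusMeasure g, toL2 torusMeasure h⟫_ℂ = ∫ ζ, (h * star g) ζ ∂torusMeasure :=
  inner_toL2_toL2 g h

/-- The variable with the negative exponent is integrated first: after conjugation its power is
positive, and Cauchy's formula at `0` makes the inner integral vanish. -/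
theorem SliceHolomorphic.dilation_mem_hardy {f : ℂ × ℂ → ℂ} (hf : SliceHolomorphic f) {r : ℝ}
    (hr : 0 < r) (hr1 : r < 1) {F : C(Torus, ℂ)}
    (hF : ∀ ζ : Torus, F ζ = f ((r : ℂ) * ζ.1, (r : ℂ) * ζ.2)) :
    toL2 torusMeasure F ∈ hardy := by
  have hr' : 1 < r⁻¹ := (one_lt_inv₀ hr).2 hr1
  refine mem_hardy_iff.2 fun m n hmn => ?_
  rw [inner_toL2_toL2_eq_integral, star_monomial]
  rcases hmn with h | h
  · obtain ⟨k, hk⟩ : ∃ k : ℕ, -m = ((k + 1 : ℕ) : ℤ) := ⟨(-m).toNat - 1, by omega⟩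
    rw [integral_torusMeasure_symm]
    refine integral_eq_zero_of_ae (.of_forall fun y => ?_)
    have h1 : ∀ x : Circle, (F * monomial (-m) (-n)) (x, y) =
        (f ((r : ℂ) * x, (r : ℂ) * y) * (x : ℂ) ^ (k + 1)) * ((y ^ (-n) : Circle) : ℂ) :=
      fun x => by
        rw [ContinuousMap.mul_apply, hF, hk, mul_assoc]
        simp only [monomial, ContinuousMap.coe_mk, Circle.coe_mul, zpow_natCast, Circle.coe_pow]
    simp_rw [h1]
    rw [integral_mul_const, integral_circle_mul_pow hr'
      (differentiableOn_dilation_left hf hr hr1 (Circle.norm_coe y).le), zero_mul]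
    rfl
  · obtain ⟨k, hk⟩ : ∃ k : ℕ, -n = ((k + 1 : ℕ) : ℤ) := ⟨(-n).toNat - 1, by omega⟩
    rw [integral_torusMeasure]
    refine integral_eq_zero_of_ae (.of_forall fun x => ?_)
    have h1 : ∀ y : Circle, (F * monomial (-m) (-n)) (x, y) =
        (f ((r : ℂ) * x, (r : ℂ) * y) * (y : ℂ) ^ (k + 1)) * ((x ^ (-m) : Circle) : ℂ) :=
      fun y => by
        rw [ContinuousMap.mul_apply, hF, hk, mul_assoc]
        simp only [monomial, ContinuousMap.coe_mk, Circle.coe_mul, zpow_natCast, Circle.coe_pow]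
        rw [mul_comm ((x ^ (-m) : Circle) : ℂ)]
    simp_rw [h1]
    rw [integral_mul_const, integral_circle_mul_pow hr'
      (differentiableOn_dilation_right hf hr hr1 x), zero_mul]
    rfl

/-- Cauchy's formula in each variable. The order matters: the second variable is integrated on
slices `z₁ = r x ≠ 0`, where holomorphy is assumed; the remaining integral runs over a slice in
`z₁`, which is holomorphic even across `z₁ = 0`. -/
theorem SliceHolomorphic.cauchyEval_dilation {f : ℂ × ℂ → ℂ} (hf : SliceHolomorphic f) {r : ℝ}
    (hr : 0 < r) (hr1 : r < 1) {F : C(Torus, ℂ)}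
    (hF : ∀ ζ : Torus, F ζ = f ((r : ℂ) * ζ.1, (r : ℂ) * ζ.2)) (z : bidisk) :
    cauchyEval z (toL2 torusMeasure F) = f ((r : ℂ) * z.1.1, (r : ℂ) * z.1.2) := by
  have hr' : 1 < r⁻¹ := (one_lt_inv₀ hr).2 hr1
  rw [cauchyEval, inner_toL2_toL2_eq_integral, integral_torusMeasure]
  have h1 : ∀ x y : Circle, (F * star (szego z)) (x, y) =
      (f ((r : ℂ) * x, (r : ℂ) * y) * (1 / (1 - conj (y : ℂ) * z.1.2))) *
        (1 / (1 - conj (x : ℂ) * z.1.1)) := fun x y => by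
    rw [ContinuousMap.mul_apply, hF, ContinuousMap.star_apply, szego_apply]
    simp only [RCLike.star_def, map_div₀, map_one, map_mul, map_sub, Complex.conj_conj]
    rw [mul_assoc, one_div_mul_one_div, mul_comm (1 - conj (y : ℂ) * z.1.2)]
  simp_rw [h1, integral_mul_const]
  have h2 : ∀ x : Circle, ∫ y : Circle, f ((r : ℂ) * x, (r : ℂ) * y) *
      (1 / (1 - conj (y : ℂ) * z.1.2)) ∂circleMeasure = f ((r : ℂ) * x, (r : ℂ) * z.1.2) :=
    fun x => integral_circle_cauchy hr' (differentiableOn_dilation_right hf hr hr1 x) z.2.2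
  simp_rw [h2]
  exact integral_circle_cauchy hr' (differentiableOn_dilation_left hf hr hr1 z.2.2.le) z.2.1

/-- A sequence of radii that increases to `1`. -/
def radius (n : ℕ) : ℝ := 1 - 1 / ((n : ℝ) + 2)

theorem radius_pos (n : ℕ) : 0 < radius n := by
  have : (1 : ℝ) / ((n : ℝ) + 2) < 1 := by
    rw [div_lt_one (by positivity)]
    linarith [(Nat.cast_nonneg n : (0 : ℝ) ≤ n)]
  rw [radius]
  linarith

theorem radius_lt_one (n : ℕ) : radius n < 1 := by
  have : (0 : ℝ) < 1 / ((n : ℝ) + 2) := by positivity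
  rw [radius]
  linarith

theorem tendsto_radius : Tendsto radius atTop (𝓝 1) := by
  have h := (tendsto_one_div_add_atTop_nhds_zero_nat (𝕜 := ℝ)).comp (tendsto_add_atTop_nat 1)
  have h2 := h.const_sub 1
  rw [sub_zero] at h2
  refine h2.congr fun n => ?_
  simp only [Function.comp, radius]
  push_cast
  ring

theorem isOpen_bidisk_fst_ne_zero : IsOpen {z : ℂ × ℂ | z ∈ bidisk ∧ z.1 ≠ 0} :=
  isOpen_bidisk.inter (isOpen_ne_fun continuous_fst continuous_const)

/-- A weak limit of dilations of a slice holomorphic function is a boundary function. -/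
theorem SliceHolomorphic.isBoundaryFunction_of_tendsto {f : ℂ × ℂ → ℂ} (hf : SliceHolomorphic f)
    {l : Filter ℕ} [l.NeBot] (hl : l ≤ atTop) {F : ℕ → C(Torus, ℂ)}
    (hF : ∀ (n : ℕ) (ζ : Torus), F n ζ = f ((radius n : ℂ) * ζ.1, (radius n : ℂ) * ζ.2))
    {b : L2 torusMeasure} (hb : ∀ g : C(Torus, ℂ),
      Tendsto (fun n => ⟪toL2 torusMeasure g, toL2 torusMeasure (F n)⟫_ℂ) l
        (𝓝 ⟪toL2 torusMeasure g, b⟫_ℂ)) :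
    IsBoundaryFunction f b := by
  have hrad : Tendsto (fun n => (radius n : ℂ)) l (𝓝 1) :=
    ((Complex.continuous_ofReal.tendsto 1).comp tendsto_radius).mono_left hl
  have hne : ∀ z : bidisk, z.1.1 ≠ 0 → f z = cauchyEval z b := fun z hz => by
    refine tendsto_nhds_unique ?_ (hb (szego z))
    have h1 : ∀ n, ⟪toL2 torusMeasure (szego z), toL2 torusMeasure (F n)⟫_ℂ =
        f ((radius n : ℂ) * z.1.1, (radius n : ℂ) * z.1.2) := fun n =>
      hf.cauchyEval_dilation (radius_pos n) (radius_lt_one n) (hF n) z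
    simp_rw [h1]
    have h2 : ContinuousAt f z.1 :=
      hf.continuousOn.continuousAt (isOpen_bidisk_fst_ne_zero.mem_nhds ⟨z.2, hz⟩)
    refine h2.tendsto.comp ?_
    have h3 := (hrad.mul_const z.1.1).prodMk_nhds (hrad.mul_const z.1.2)
    rwa [one_mul, one_mul] at h3
  refine isBoundaryFunction_iff.2 ⟨mem_hardy_iff.2 fun m n hmn => ?_, fun z => ?_⟩
  · refine tendsto_nhds_unique (hb (monomial m n)) ?_
    have h1 : ∀ k, ⟪toL2 torusMeasure (monomial m n), toL2 torusMeasure (F k)⟫_ℂ = 0 := fun k =>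
      mem_hardy_iff.1 (hf.dilation_mem_hardy (radius_pos k) (radius_lt_one k) (hF k)) m n hmn
    simp_rw [h1]
    exact tendsto_const_nhds
  -- At `z₁ = 0` both sides are limits along the slice `s ↦ (s, z₂)`, `s → 0`, on which they already
  -- agree.
  · rcases ne_or_eq z.1.1 0 with hz | hz
    · exact hne z hz
    · have hz2 : ‖z.1.2‖ < 1 := z.2.2
      have h1 : Tendsto (fun s => f (s, z.1.2)) (𝓝[≠] 0) (𝓝 (f (0, z.1.2))) :=
        (((hf.left _ hz2).continuousOn).continuousAt
          (Metric.ball_mem_nhds 0 one_pos)).tendsto.mono_left nhdsWithin_le_nhds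
      have h2 : Tendsto (fun s : ℂ => ⟪toL2 torusMeasure (cauchyKernel (conj s, conj z.1.2)), b⟫_ℂ)
          (𝓝[≠] 0) (𝓝 ⟪toL2 torusMeasure (cauchyKernel (conj 0, conj z.1.2)), b⟫_ℂ) := by
        refine Tendsto.mono_left ?_ nhdsWithin_le_nhds
        refine Tendsto.inner ?_ tendsto_const_nhds
        refine ((ContinuousMap.toLp (E := ℂ) 2 torusMeasure ℂ).continuous.tendsto _).comp ?_
        have h0 : ((conj 0, conj z.1.2) : ℂ × ℂ) ∈ bidisk := by simpa [bidisk] using hz2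
        exact ContinuousAt.comp (x := (0 : ℂ)) (g := cauchyKernel)
          (f := fun s : ℂ => (conj s, conj z.1.2))
          (differentiableAt_cauchyKernel h0).continuousAt (by fun_prop)
      have h3 : (fun s => f (s, z.1.2)) =ᶠ[𝓝[≠] 0]
          fun s : ℂ => ⟪toL2 torusMeasure (cauchyKernel (conj s, conj z.1.2)), b⟫_ℂ := by
        filter_upwards [self_mem_nhdsWithin,
          nhdsWithin_le_nhds (Metric.ball_mem_nhds (0 : ℂ) one_pos)] with s hs0 hs
        have h4 := hne ⟨(s, z.1.2), by simpa using hs, hz2⟩ hs0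
        rw [cauchyEval, szego_eq_cauchyKernel] at h4
        exact h4
      have h5 := tendsto_nhds_unique (h1.congr' h3) h2
      rw [cauchyEval, szego_eq_cauchyKernel, hz, ← h5, ← hz]

/-- Bounded sequences in a Hilbert space have weak limits along an ultrafilter. -/
theorem exists_weak_limit {H : Type*} [NormedAddCommGroup H] [InnerProductSpace ℂ H]
    [CompleteSpace H] (l : Ultrafilter ℕ) (x : ℕ → H) (C : ℝ) (hx : ∀ n, ‖x n‖ ≤ C) :
    ∃ b : H, ∀ g : H, Tendsto (fun n => ⟪g, x n⟫_ℂ) l (𝓝 ⟪g, b⟫_ℂ) := by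
  -- Banach–Alaoglu for the functionals `⟨x n, ·⟩`; the limit functional is turned into a vector by
  -- the Riesz representation, and a conjugation restores the order of the inner product.
  let y : ℕ → WeakDual ℂ H := fun n =>
    StrongDual.toWeakDual (InnerProductSpace.toDual ℂ H (x n))
  have hy : ∀ n, y n ∈ WeakDual.toStrongDual ⁻¹' Metric.closedBall (0 : StrongDual ℂ H) C :=
    fun n => by
      rw [mem_preimage, mem_closedBall_zero_iff]
      change ‖InnerProductSpace.toDual ℂ H (x n)‖ ≤ C
      rw [LinearIsometryEquiv.norm_map]
      exact hx n
  obtain ⟨L, -, hL⟩ := (WeakDual.isCompact_closedBall (𝕜 := ℂ) (E := H) 0 C).ultrafilter_le_nhds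
    (l.map y) (le_principal_iff.2 (Filter.mem_map.2 (Filter.univ_mem' hy)))
  refine ⟨(InnerProductSpace.toDual ℂ H).symm (WeakDual.toStrongDual L), fun g => ?_⟩
  have h1 : Tendsto (fun n => y n g) l (𝓝 (L g)) :=
    ((WeakDual.eval_continuous g).tendsto L).comp hL
  have h2 := (Complex.continuous_conj.tendsto _).comp h1
  have h3 : ⟪g, (InnerProductSpace.toDual ℂ H).symm (WeakDual.toStrongDual L)⟫_ℂ = conj (L g) := by
    rw [← inner_conj_symm, InnerProductSpace.toDual_symm_apply]
    rfl
  rw [h3]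
  refine h2.congr fun n => ?_
  simp only [Function.comp]
  rw [← inner_conj_symm]
  rfl

/-- A square integrable function that pairs with `L²` functions like a function bounded by `C` is
bounded by `C`. -/
theorem ae_norm_le_of_norm_inner_le {μ : Measure Torus} [IsFiniteMeasure μ] {b : L2 μ} {C : ℝ}
    (hC : 0 ≤ C) (h : ∀ g : L2 μ, ‖⟪g, b⟫_ℂ‖ ≤ C * ∫ ζ, ‖g ζ‖ ∂μ) : ∀ᵐ ζ ∂μ, ‖b ζ‖ ≤ C := by
  set E : Set Torus := {ζ | C < ‖b ζ‖} with hE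
  have hEm : MeasurableSet E :=
    measurableSet_lt measurable_const (Lp.stronglyMeasurable b).norm.measurable
  -- The test function is `b` cut off to the set where the bound fails: the hypothesis gives `∫_E
  -- |b|² ≤ C ∫_E |b|`, while `|b|² > C |b|` on `E`, so `E` is null.
  have hmem : MemLp (E.indicator b) 2 μ := (Lp.memLp b).indicator hEm
  have hsq : Integrable (fun ζ => ‖b ζ‖ ^ 2) μ :=
    (memLp_two_iff_integrable_sq_norm (Lp.aestronglyMeasurable b)).1 (Lp.memLp b)
  have hno : Integrable (fun ζ => ‖b ζ‖) μ := ((Lp.memLp b).integrable one_le_two).norm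
  have h1 : ⟪hmem.toLp _, b⟫_ℂ = ((∫ ζ, E.indicator (fun ζ => ‖b ζ‖ ^ 2) ζ ∂μ : ℝ) : ℂ) := by
    rw [L2.inner_def, ← integral_complex_ofReal]
    refine integral_congr_ae ?_
    filter_upwards [hmem.coeFn_toLp] with ζ hζ
    rw [hζ, RCLike.inner_apply]
    by_cases hm : ζ ∈ E
    · simp [hm, Complex.mul_conj']
    · simp [hm]
  have h2 : ∫ ζ, ‖hmem.toLp _ ζ‖ ∂μ = ∫ ζ, E.indicator (fun ζ => ‖b ζ‖) ζ ∂μ := by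
    refine integral_congr_ae ?_
    filter_upwards [hmem.coeFn_toLp] with ζ hζ
    rw [hζ, norm_indicator_eq_indicator_norm]
  have h3 := h (hmem.toLp _)
  rw [h1, h2, Complex.norm_real, ← integral_const_mul] at h3
  have h4 := (le_abs_self _).trans h3
  rw [← sub_nonpos, ← integral_sub (hsq.indicator hEm) ((hno.indicator hEm).const_mul C)] at h4
  have hnn : ∀ ζ, 0 ≤ E.indicator (fun ζ => ‖b ζ‖ ^ 2) ζ - C * E.indicator (fun ζ => ‖b ζ‖) ζ := by
    intro ζ
    by_cases hm : ζ ∈ E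
    · simp only [hm, indicator_of_mem]
      have : C < ‖b ζ‖ := hm
      nlinarith [norm_nonneg (b ζ)]
    · simp [hm]
  have h5 := (integral_eq_zero_iff_of_nonneg hnn
    ((hsq.indicator hEm).sub ((hno.indicator hEm).const_mul C))).1
    (le_antisymm h4 (integral_nonneg hnn))
  filter_upwards [h5] with ζ hζ
  by_contra hcon
  have hm : ζ ∈ E := not_le.1 hcon
  simp only [hm, indicator_of_mem, Pi.zero_apply] at hζ
  have : C < ‖b ζ‖ := hm
  have hb0 : ‖b ζ‖ * (‖b ζ‖ - C) = 0 := by linear_combination hζ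
  rcases mul_eq_zero.1 hb0 with h6 | h6
  · linarith
  · linarith

/-- The dilations are uniformly bounded, so they have a weak limit along an ultrafilter. No
pointwise boundary limits are required, and the sup bound passes to the limit through the pairing
with `L²` functions. -/
theorem SliceHolomorphic.exists_boundaryFunction {f : ℂ × ℂ → ℂ} (hf : SliceHolomorphic f)
    (hC : BoundedOnBidisk f) :
    ∃ b, IsBoundaryFunction f b ∧ MemLp b ∞ torusMeasure := by
  obtain ⟨C, hC⟩ := hC
  choose F hF using fun n => hf.exists_dilation (radius_pos n) (radius_lt_one n)
  have hFC : ∀ n ζ, ‖F n ζ‖ ≤ C := fun n ζ => by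
    rw [hF]
    exact hC _ (ofReal_mul_mem_bidisk (radius_pos n) (radius_lt_one n) ζ)
  obtain ⟨b, hb⟩ := exists_weak_limit (hyperfilter ℕ) (fun n => toL2 torusMeasure (F n)) C
    fun n => by
      have h := Lp.norm_le_of_ae_bound (f := toL2 torusMeasure (F n))
        ((norm_nonneg _).trans (hFC n 1)) (by
          filter_upwards [toL2_ae (μ := torusMeasure) (F n)] with ζ hζ
          rw [hζ]
          exact hFC n ζ)
      simpa [measureUnivNNReal] using h
  refine ⟨b, hf.isBoundaryFunction_of_tendsto Nat.hyperfilter_le_atTop hF fun g => hb _,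
    memLp_top_of_bound (Lp.aestronglyMeasurable b) C (ae_norm_le_of_norm_inner_le
      ((norm_nonneg _).trans (hFC 0 1)) fun g => ?_)⟩
  refine le_of_tendsto (hb g).norm (.of_forall fun n => ?_)
  rw [L2.inner_def, ← integral_const_mul]
  refine norm_integral_le_of_norm_le
    (((Lp.memLp g).integrable one_le_two).norm.const_mul C) ?_
  filter_upwards [toL2_ae (μ := torusMeasure) (F n)] with ζ hζ
  rw [hζ, RCLike.inner_apply, norm_mul, RCLike.norm_conj]
  exact mul_le_mul_of_nonneg_right (hFC n ζ) (norm_nonneg _)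

/-! ### Inner functions -/

/-- Radii lie in Stolz regions of every aperture exceeding `1`; the aperture `2` is an arbitrary
choice. -/
theorem tendsto_radial {f : ℂ × ℂ → ℂ} {ζ : Torus} {c : ℂ} (h : HasNontangentialLimit f ζ c) :
    Tendsto (fun n => f ((radius n : ℂ) * ζ.1, (radius n : ℂ) * ζ.2)) atTop (𝓝 c) := by
  have key : ∀ (n : ℕ) (x : Circle), ‖(radius n : ℂ) * x - x‖ ≤ 2 * (1 - ‖(radius n : ℂ) * x‖) := by
    intro n x
    rw [norm_ofReal_mul_circle (radius_pos n), ← sub_one_mul, norm_mul, Circle.norm_coe, mul_one,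
      ← Complex.ofReal_one, ← Complex.ofReal_sub, Complex.norm_real, Real.norm_eq_abs,
      abs_sub_comm, abs_of_pos (sub_pos.2 (radius_lt_one n))]
    linarith [radius_lt_one n]
  refine (h 2 one_lt_two).comp (tendsto_nhdsWithin_iff.2 ⟨?_, .of_forall fun n =>
    ⟨ofReal_mul_mem_bidisk (radius_pos n) (radius_lt_one n) ζ, key n ζ.1, key n ζ.2⟩⟩)
  have hrad : Tendsto (fun n => (radius n : ℂ)) atTop (𝓝 1) :=
    (Complex.continuous_ofReal.tendsto 1).comp tendsto_radius
  have h3 := (hrad.mul_const (ζ.1 : ℂ)).prodMk_nhds (hrad.mul_const (ζ.2 : ℂ))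
  rwa [one_mul, one_mul] at h3

/-- The boundary function of an inner function is unimodular. -/
theorem IsInner.exists_boundaryFunction {φ : ℂ × ℂ → ℂ} (hφ : IsInner φ) :
    ∃ b, IsBoundaryFunction φ b ∧ ∀ᵐ ζ ∂torusMeasure, ‖b ζ‖ = 1 := by
  have hs := sliceHolomorphic_of_differentiableOn hφ.differentiableOn
  obtain ⟨C, hC⟩ := hφ.bounded
  choose F hF using fun n => hs.exists_dilation (radius_pos n) (radius_lt_one n)
  have hFC : ∀ n ζ, ‖F n ζ‖ ≤ C := fun n ζ => by
    rw [hF]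
    exact hC _ (ofReal_mul_mem_bidisk (radius_pos n) (radius_lt_one n) ζ)
  have hlim : ∀ᵐ ζ ∂torusMeasure, ∃ c : ℂ, Tendsto (fun n => F n ζ) atTop (𝓝 c) := by
    filter_upwards [hφ.unimodular] with ζ hζ
    obtain ⟨c, hc, -⟩ := hζ
    refine ⟨c, ?_⟩
    simp_rw [hF]
    exact tendsto_radial hc
  -- The radial limit serves as boundary function: dominated convergence with the bound `C` for `φ`
  -- turns almost everywhere convergence into the weak convergence needed.
  obtain ⟨g, hgm, hg⟩ := measurable_limit_of_tendsto_metrizable_ae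
    (fun n => (F n).continuous.aemeasurable) hlim
  have hg1 : ∀ᵐ ζ ∂torusMeasure, ‖g ζ‖ = 1 := by
    filter_upwards [hφ.unimodular, hg] with ζ hζ hgζ
    obtain ⟨c, hc, hc1⟩ := hζ
    simp_rw [hF] at hgζ
    rw [tendsto_nhds_unique hgζ (tendsto_radial hc), hc1]
  have hmem : MemLp g 2 torusMeasure :=
    MemLp.of_bound hgm.aestronglyMeasurable 1 (hg1.mono fun _ h => h.le)
  refine ⟨hmem.toLp g, hs.isBoundaryFunction_of_tendsto le_rfl hF fun h => ?_, ?_⟩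
  · simp_rw [inner_toL2_toL2]
    have h1 : ⟪toL2 torusMeasure h, hmem.toLp g⟫_ℂ = ∫ ζ, g ζ * conj (h ζ) ∂torusMeasure := by
      rw [inner_toL2]
      refine integral_congr_ae ?_
      filter_upwards [hmem.coeFn_toLp] with ζ hζ
      rw [hζ]
    rw [h1]
    refine tendsto_integral_of_dominated_convergence (fun _ => C * ‖h‖)
      (fun n => ((F n).continuous.mul
        (Complex.continuous_conj.comp h.continuous)).aestronglyMeasurable)
      (integrable_const _) (fun n => .of_forall fun ζ => ?_) ?_
    · rw [norm_mul, RCLike.norm_conj]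
      exact mul_le_mul (hFC n ζ) (h.norm_coe_le_norm ζ) (norm_nonneg _)
        ((norm_nonneg _).trans (hFC n ζ))
    · filter_upwards [hg] with ζ hζ
      exact hζ.mul_const _
  · filter_upwards [hmem.coeFn_toLp, hg1] with ζ h1 h2
    rw [h1, h2]

section Inner

variable {φ : ℂ × ℂ → ℂ}

theorem IsInner.isBoundaryFunction (hφ : IsInner φ) :
    IsBoundaryFunction φ (boundaryFunction φ) := by
  obtain ⟨b, hb, -⟩ := hφ.exists_boundaryFunction
  rwa [hb.eq_boundaryFunction]

theorem IsInner.norm_boundaryFunction (hφ : IsInner φ) :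
    ∀ᵐ ζ ∂torusMeasure, ‖boundaryFunction φ ζ‖ = 1 := by
  obtain ⟨b, hb, hb1⟩ := hφ.exists_boundaryFunction
  rwa [hb.eq_boundaryFunction]

theorem IsInner.memLp_boundaryFunction (hφ : IsInner φ) :
    MemLp (boundaryFunction φ) ∞ torusMeasure :=
  memLp_top_of_bound (Lp.aestronglyMeasurable _) 1 (hφ.norm_boundaryFunction.mono fun _ h => h.le)

theorem IsInner.boundaryFunction_mem (hφ : IsInner φ) : boundaryFunction φ ∈ hardy :=
  hφ.isBoundaryFunction.1

theorem IsInner.cauchyEval_boundaryFunction (hφ : IsInner φ) (z : bidisk) :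
    cauchyEval z (boundaryFunction φ) = φ z :=
  ((isBoundaryFunction_iff.1 hφ.isBoundaryFunction).2 z).symm

theorem IsInner.mulOp_mem_hardy (hφ : IsInner φ) {g : L2 torusMeasure} (hg : g ∈ hardy) :
    mulOp torusMeasure (boundaryFunction φ) g ∈ hardy :=
  (mulOp_mem_hardy_and_cauchyEval hφ.boundaryFunction_mem hφ.memLp_boundaryFunction hg).1

theorem IsInner.cauchyEval_mulOp (hφ : IsInner φ) {g : L2 torusMeasure} (hg : g ∈ hardy)
    (z : bidisk) :
    cauchyEval z (mulOp torusMeasure (boundaryFunction φ) g) = φ z * cauchyEval z g := by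
  rw [(mulOp_mem_hardy_and_cauchyEval hφ.boundaryFunction_mem hφ.memLp_boundaryFunction hg).2,
    hφ.cauchyEval_boundaryFunction]

/-- Every power `φⁿ` lies in the unit ball of `H²` because multiplication by `φ` is isometric.
Evaluation at `z` is bounded by `‖k_z‖`, so `|φ(z)|ⁿ ≤ ‖k_z‖` for all `n`, which is impossible if
`|φ(z)| > 1`. -/
theorem IsInner.norm_le_one (hφ : IsInner φ) {z : ℂ × ℂ} (hz : z ∈ bidisk) : ‖φ z‖ ≤ 1 := by
  let z' : bidisk := ⟨z, hz⟩
  have key : ∀ n : ℕ, ∃ g ∈ hardy, ‖g‖ ≤ 1 ∧ cauchyEval z' g = φ z ^ n := fun n => by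
    induction n with
    | zero =>
      refine ⟨toL2 torusMeasure 1, by simpa using monomial_mem_hardy 0 0, ?_, ?_⟩
      · have h : ⟪toL2 torusMeasure 1, toL2 torusMeasure 1⟫_ℂ = 1 := by
          rw [inner_toL2_toL2]; simp
        have h2 : ‖toL2 torusMeasure 1‖ ^ 2 = 1 := by
          rw [@norm_sq_eq_re_inner ℂ, h, RCLike.one_re]
        nlinarith [norm_nonneg (toL2 torusMeasure 1)]
      · rw [cauchyEval_one, pow_zero]
    | succ n ih =>
      obtain ⟨g, hg, hg1, hgz⟩ := ih
      refine ⟨_, hφ.mulOp_mem_hardy hg, ?_, ?_⟩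
      · have h := inner_mulOp_mulOp_of_norm_eq_one hφ.memLp_boundaryFunction
          hφ.norm_boundaryFunction g g
        rw [inner_self_eq_norm_sq_to_K, inner_self_eq_norm_sq_to_K] at h
        have h2 : ‖mulOp torusMeasure (boundaryFunction φ) g‖ ^ 2 = ‖g‖ ^ 2 := by exact_mod_cast h
        rw [pow_left_inj₀ (norm_nonneg _) (norm_nonneg _) two_ne_zero] at h2
        rwa [h2]
      · rw [hφ.cauchyEval_mulOp hg, hgz, pow_succ']
  by_contra! hcon
  obtain ⟨n, hn⟩ := pow_unbounded_of_one_lt ‖toL2 torusMeasure (szego z')‖ hcon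
  obtain ⟨g, -, hg1, hgz⟩ := key n
  have h := norm_inner_le_norm (𝕜 := ℂ) (toL2 torusMeasure (szego z')) g
  rw [cauchyEval] at hgz
  rw [hgz, norm_pow] at h
  nlinarith [norm_nonneg (toL2 torusMeasure (szego z'))]

theorem convex_bidisk : Convex ℝ bidisk := by
  have h : bidisk = Metric.ball (0 : ℂ) 1 ×ˢ Metric.ball (0 : ℂ) 1 := by
    ext z; simp [bidisk]
  rw [h]
  exact (convex_ball _ _).prod (convex_ball _ _)

/-- By the maximum principle, a nonconstant inner function takes no unimodular values. -/
theorem IsInner.ne_circle (hφ : IsInner φ) {α : Circle} (hα : ∃ z ∈ bidisk, φ z ≠ α) {z : ℂ × ℂ}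
    (hz : z ∈ bidisk) : φ z ≠ α := by
  intro h
  obtain ⟨w, hw, hne⟩ := hα
  refine hne ?_
  rw [← h]
  refine Complex.eqOn_of_isPreconnected_of_isMaxOn_norm convex_bidisk.isPreconnected isOpen_bidisk
    hφ.differentiableOn hz (fun u hu => ?_) hw
  change ‖φ u‖ ≤ ‖φ z‖
  rw [h, Circle.norm_coe]
  exact hφ.norm_le_one hu

theorem one_sub_conj_circle_mul_ne_zero {α : Circle} {c : ℂ} (hc : c ≠ α) :
    1 - conj (α : ℂ) * c ≠ 0 := by
  intro h
  refine hc ?_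
  linear_combination (-(α : ℂ)) * h + (-c) * coe_mul_conj_coe α

theorem one_sub_circle_mul_conj_ne_zero {α : Circle} {c : ℂ} (hc : c ≠ α) :
    1 - (α : ℂ) * conj c ≠ 0 := by
  have h := (map_ne_zero (starRingEnd ℂ)).2 (one_sub_conj_circle_mul_ne_zero hc)
  simpa using h

end Inner

/-! ### Polarization of the Clark formula -/

/-- Identity theorem: the real points of `s` accumulate at `0`. -/
theorem eq_zero_of_analytic_of_real {g : ℂ → ℂ} {s : Set ℂ} (hs : IsOpen s) (hc : Convex ℝ s)
    (h0 : 0 ∈ s) (hg : DifferentiableOn ℂ g s) (hz : ∀ x : ℝ, (x : ℂ) ∈ s → g x = 0) {w : ℂ}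
    (hw : w ∈ s) : g w = 0 := by
  refine (hg.analyticOnNhd hs).eqOn_zero_of_preconnected_of_frequently_eq_zero
    hc.isPreconnected h0 ?_ hw
  have h1 : Tendsto (fun x : ℝ => (x : ℂ)) (𝓝[≠] 0) (𝓝[≠] 0) := by
    refine tendsto_nhdsWithin_iff.2 ⟨?_, ?_⟩
    · exact (Complex.continuous_ofReal.tendsto 0).mono_left nhdsWithin_le_nhds
    · filter_upwards [self_mem_nhdsWithin] with x hx
      exact Complex.ofReal_ne_zero.2 hx
  refine h1.frequently (Eventually.frequently ?_)
  have h2 : ∀ᶠ x : ℝ in 𝓝[≠] 0, (x : ℂ) ∈ s :=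
    (h1.mono_right nhdsWithin_le_nhds).eventually (hs.mem_nhds h0)
  exact h2.mono fun x hx => hz x hx

/-- A function holomorphic on the bidisk that vanishes on the totally real set `v = conj u`
vanishes identically. -/
theorem eq_zero_of_diagonal {G : ℂ × ℂ → ℂ} (hG : DifferentiableOn ℂ G bidisk)
    (h : ∀ u : ℂ, ‖u‖ < 1 → G (u, conj u) = 0) {p : ℂ × ℂ} (hp : p ∈ bidisk) : G p = 0 := by
  -- In the coordinates `u = x + i y`, `v = x - i y` the set `v = conj u` becomes the set of real
  -- `(x, y)`, and the one-variable identity theorem applies first in `y` for real `x`, then in `x`.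
  let L : ℂ × ℂ → ℂ × ℂ := fun q => (q.1 + Complex.I * q.2, q.1 - Complex.I * q.2)
  have hL : Differentiable ℂ L := by unfold L; fun_prop
  have hopen : IsOpen (L ⁻¹' bidisk) := isOpen_bidisk.preimage hL.continuous
  have hconv : Convex ℝ (L ⁻¹' bidisk) := by
    let L' : ℂ × ℂ →ₗ[ℝ] ℂ × ℂ :=
      { toFun := L
        map_add' := fun x y => by ext <;> simp only [L, Prod.fst_add, Prod.snd_add] <;> ring
        map_smul' := fun c x => by
          ext <;> simp only [L, Prod.smul_fst, Prod.smul_snd, Complex.real_smul,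
            RingHom.id_apply] <;> ring }
    exact convex_bidisk.linear_preimage L'
  have hGL : DifferentiableOn ℂ (G ∘ L) (L ⁻¹' bidisk) :=
    hG.comp hL.differentiableOn fun _ hq => hq
  have hfst : ∀ x y : ℂ, L (x, y) ∈ bidisk → L (x, 0) ∈ bidisk := fun x y hxy => by
    have h1 : ‖x + Complex.I * y‖ < 1 := hxy.1
    have h2 : ‖x - Complex.I * y‖ < 1 := hxy.2
    have h3 : ‖2 * x‖ < 2 := by
      calc ‖2 * x‖ = ‖(x + Complex.I * y) + (x - Complex.I * y)‖ := by congr 1; ring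
        _ ≤ _ := norm_add_le _ _
        _ < 2 := by linarith
    rw [norm_mul, Complex.norm_ofNat] at h3
    have h4 : ‖x‖ < 1 := by linarith
    simpa [L, bidisk] using h4
  have hsnd : ∀ x y : ℂ, L (x, y) ∈ bidisk → L (0, y) ∈ bidisk := fun x y hxy => by
    have h1 : ‖x + Complex.I * y‖ < 1 := hxy.1
    have h2 : ‖x - Complex.I * y‖ < 1 := hxy.2
    have h3 : ‖2 * (Complex.I * y)‖ < 2 := by
      calc ‖2 * (Complex.I * y)‖ = ‖(x + Complex.I * y) - (x - Complex.I * y)‖ := by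
            congr 1; ring
        _ ≤ _ := norm_sub_le _ _
        _ < 2 := by linarith
    rw [norm_mul, norm_mul, Complex.norm_ofNat, Complex.norm_I] at h3
    have h4 : ‖y‖ < 1 := by linarith
    simpa [L, bidisk] using h4
  have hreal : ∀ (x : ℝ) (y : ℂ), L (x, y) ∈ bidisk → G (L (x, y)) = 0 := fun x y hxy => by
    refine eq_zero_of_analytic_of_real (g := fun y => G (L (x, y)))
      (s := {y | L (x, y) ∈ bidisk}) (hopen.preimage (by fun_prop)) ?_ (hfst _ _ hxy)
      (hGL.comp (f := fun y => ((x : ℂ), y)) (by fun_prop) fun _ hy => hy) (fun t ht => ?_) hxy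
    · intro a ha b hb r s hr hs hrs
      have h1 := hconv (x := ((x : ℂ), a)) ha (y := ((x : ℂ), b)) hb hr hs hrs
      rwa [Prod.smul_mk, Prod.smul_mk, Prod.mk_add_mk, Convex.combo_self hrs] at h1
    · have h1 : L ((x : ℂ), (t : ℂ)) = ((x : ℂ) + Complex.I * t, conj ((x : ℂ) + Complex.I * t)) := by
        simp [L, sub_eq_add_neg]
      change G (L ((x : ℂ), (t : ℂ))) = 0
      rw [h1]
      exact h _ ht.1
  have hall : ∀ x y : ℂ, L (x, y) ∈ bidisk → G (L (x, y)) = 0 := fun x y hxy => by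
    refine eq_zero_of_analytic_of_real (g := fun x => G (L (x, y)))
      (s := {x | L (x, y) ∈ bidisk}) (hopen.preimage (by fun_prop)) ?_ (hsnd _ _ hxy)
      (hGL.comp (f := fun x => (x, y)) (by fun_prop) fun _ hx => hx)
      (fun t ht => hreal t y ht) hxy
    intro a ha b hb r s hr hs hrs
    have h1 := hconv (x := (a, y)) ha (y := (b, y)) hb hr hs hrs
    rwa [Prod.smul_mk, Prod.smul_mk, Prod.mk_add_mk, Convex.combo_self hrs] at h1
  have h1 : L ((p.1 + p.2) / 2, -Complex.I * (p.1 - p.2) / 2) = p := by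
    ext
    · simp only [L]
      linear_combination (-(p.1 - p.2) / 2) * Complex.I_mul_I
    · simp only [L]
      linear_combination ((p.1 - p.2) / 2) * Complex.I_mul_I
  rw [← h1]
  exact hall _ _ (by rw [h1]; exact hp)

/-- A function of two pairs of variables that is holomorphic, in pairs, on the polydisk and
vanishes on `u = conj z` vanishes identically. -/
theorem eq_zero_of_diagonal_prod {G : (ℂ × ℂ) × (ℂ × ℂ) → ℂ}
    (hG : DifferentiableOn ℂ G (bidisk ×ˢ bidisk))
    (h : ∀ z ∈ bidisk, G (z, (conj z.1, conj z.2)) = 0) {z u : ℂ × ℂ} (hz : z ∈ bidisk)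
    (hu : u ∈ bidisk) : G (z, u) = 0 := by
  -- The first coordinates of the two pairs are freed from the diagonal while the second ones stay
  -- on it; the second ones are freed next.
  have h1 : ∀ t : ℂ, ‖t‖ < 1 → ∀ p ∈ bidisk, G ((p.1, t), (p.2, conj t)) = 0 :=
    fun t ht p hp => by
      have ht' : ‖conj t‖ < 1 := by simpa using ht
      refine eq_zero_of_diagonal (G := fun p => G ((p.1, t), (p.2, conj t)))
        (hG.comp (f := fun p : ℂ × ℂ => ((p.1, t), (p.2, conj t))) (by fun_prop)
          fun q hq => ⟨⟨hq.1, ht⟩, ⟨hq.2, ht'⟩⟩) (fun s hs => ?_) hp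
      exact h (s, t) ⟨hs, ht⟩
  have h2 := eq_zero_of_diagonal (G := fun p => G ((z.1, p.1), (u.1, p.2)))
    (hG.comp (f := fun p : ℂ × ℂ => ((z.1, p.1), (u.1, p.2))) (by fun_prop)
      fun q hq => ⟨⟨hz.1, hq.1⟩, ⟨hu.1, hq.2⟩⟩) (fun t ht => h1 t ht (z.1, u.1) ⟨hz.1, hu.1⟩)
    (p := (z.2, u.2)) ⟨hz.2, hu.2⟩
  exact h2

/-- The function `z ↦ conj (f (conj z))`. -/
def conjConj (f : ℂ × ℂ → ℂ) (z : ℂ × ℂ) : ℂ := conj (f (conj z.1, conj z.2))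

theorem differentiableOn_conjConj {f : ℂ × ℂ → ℂ} (hf : DifferentiableOn ℂ f bidisk) :
    DifferentiableOn ℂ (conjConj f) bidisk := by
  intro z hz
  have h1 := (hf.differentiableAt (isOpen_bidisk.mem_nhds (conj_mem_bidisk hz))).star_star
  have h2 : star ((conj z.1, conj z.2) : ℂ × ℂ) = z := by
    ext <;> simp [RCLike.star_def]
  rw [h2] at h1
  exact h1.differentiableWithinAt

theorem differentiableOn_star_cauchyKernel :
    DifferentiableOn ℂ (fun z : ℂ × ℂ => star (cauchyKernel (conj z.1, conj z.2))) bidisk := by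
  intro z hz
  have h1 := (differentiableAt_cauchyKernel (conj_mem_bidisk hz)).star_star
  have h2 : star ((conj z.1, conj z.2) : ℂ × ℂ) = z := by
    ext <;> simp [RCLike.star_def]
  rw [h2] at h1
  exact h1.differentiableWithinAt

/-- For unimodular `x` one has `|1 - x conj a| = |x - a|`, so `|k_z|²` is the Poisson kernel up to
normalization. -/
theorem szego_mul_star_szego_self (z : bidisk) (ζ : Torus) :
    szego z ζ * conj (szego z ζ) * (((1 - ‖z.1.1‖ ^ 2) * (1 - ‖z.1.2‖ ^ 2) : ℝ) : ℂ) =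
      ((poisson z.1.1 ζ.1 * poisson z.1.2 ζ.2 : ℝ) : ℂ) := by
  have key : ∀ (x : Circle) (a : ℂ), ‖1 - (x : ℂ) * conj a‖ = ‖(x : ℂ) - a‖ := fun x a => by
    have h : (x : ℂ) * conj ((x : ℂ) - a) = 1 - (x : ℂ) * conj a := by
      rw [map_sub, mul_sub, coe_mul_conj_coe]
    rw [← h, norm_mul, Circle.norm_coe, one_mul, RCLike.norm_conj]
  rw [Complex.mul_conj', szego_apply, norm_div, norm_one, norm_mul, key, key, poisson, poisson]
  push_cast
  ring

section Clark

variable {φ : ℂ × ℂ → ℂ} {α : Circle} {σ : Measure Torus} [IsFiniteMeasure σ]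

theorem IsClarkMeasure.inner_szego_self (hσ : IsClarkMeasure φ α σ) (z : bidisk) :
    ⟪toL2 σ (szego z), toL2 σ (szego z)⟫_ℂ * ((1 - ‖z.1.1‖ ^ 2) * (1 - ‖z.1.2‖ ^ 2) : ℝ) =
      ((1 - ‖φ z‖ ^ 2) / ‖(α : ℂ) - φ z‖ ^ 2 : ℝ) := by
  rw [hσ z z.2, inner_toL2_toL2, ← integral_mul_const, ← integral_complex_ofReal]
  exact integral_congr_ae (.of_forall fun ζ => szego_mul_star_szego_self z ζ)

/-- Polarization of the Clark formula: the diagonal case `w = z` is the formula itself, and both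
sides are holomorphic in `z` and in `conj w`. -/
theorem IsClarkMeasure.inner_szego (hφ : IsInner φ) (hα : ∃ z ∈ bidisk, φ z ≠ α)
    (hσ : IsClarkMeasure φ α σ) (z w : bidisk) :
    (1 - conj (α : ℂ) * φ z) * (1 - α * conj (φ w)) *
        ⟪toL2 σ (szego z), toL2 σ (szego w)⟫_ℂ =
      (1 - φ z * conj (φ w)) * (1 / ((1 - z.1.1 * conj w.1.1) * (1 - z.1.2 * conj w.1.2))) := by
  let A : C(Torus, ℂ) →L[ℂ] ℂ := (innerSL ℂ (toL2 σ 1)) ∘L ContinuousMap.toLp (E := ℂ) 2 σ ℂ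
  have hA : ∀ g h : C(Torus, ℂ), A (g * star h) = ⟪toL2 σ h, toL2 σ g⟫_ℂ := fun g h => by
    change ⟪toL2 σ 1, toL2 σ (g * star h)⟫_ℂ = _
    rw [inner_toL2_toL2, inner_toL2_toL2]
    simp
  -- The difference of the two sides with denominators cleared, `p.2` standing for `conj w`. The
  -- double conjugations make the dependence on `p.1` holomorphic.
  let G : (ℂ × ℂ) × (ℂ × ℂ) → ℂ := fun p =>
    (1 - conj (α : ℂ) * φ p.1) * (1 - α * conjConj φ p.2) *
      A (cauchyKernel p.2 * star (cauchyKernel (conj p.1.1, conj p.1.2))) *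
      ((1 - p.1.1 * p.2.1) * (1 - p.1.2 * p.2.2)) - (1 - φ p.1 * conjConj φ p.2)
  have hconj : ∀ z : ℂ × ℂ, conjConj φ (conj z.1, conj z.2) = conj (φ z) := fun z => by
    simp [conjConj]
  have hφ1 : DifferentiableOn ℂ (fun p : (ℂ × ℂ) × (ℂ × ℂ) => φ p.1) (bidisk ×ˢ bidisk) :=
    hφ.differentiableOn.comp differentiableOn_fst fun _ hp => hp.1
  have hφ2 : DifferentiableOn ℂ (fun p : (ℂ × ℂ) × (ℂ × ℂ) => conjConj φ p.2)
      (bidisk ×ˢ bidisk) :=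
    (differentiableOn_conjConj hφ.differentiableOn).comp differentiableOn_snd fun _ hp => hp.2
  have hk1 : DifferentiableOn ℂ (fun p : (ℂ × ℂ) × (ℂ × ℂ) =>
      star (cauchyKernel (conj p.1.1, conj p.1.2))) (bidisk ×ˢ bidisk) :=
    differentiableOn_star_cauchyKernel.comp differentiableOn_fst fun _ hp => hp.1
  have hk2 : DifferentiableOn ℂ (fun p : (ℂ × ℂ) × (ℂ × ℂ) => cauchyKernel p.2)
      (bidisk ×ˢ bidisk) := fun p hp =>
    ((differentiableAt_cauchyKernel hp.2).comp p differentiableAt_snd).differentiableWithinAt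
  have hG : DifferentiableOn ℂ G (bidisk ×ˢ bidisk) := by
    refine DifferentiableOn.sub (DifferentiableOn.mul (DifferentiableOn.mul (DifferentiableOn.mul
      ?_ ?_) ?_) ?_) ?_
    · exact (hφ1.const_mul _).const_sub _
    · exact (hφ2.const_mul _).const_sub _
    · exact A.differentiable.comp_differentiableOn (hk2.mul hk1)
    · fun_prop
    · exact (hφ1.mul hφ2).const_sub _
  have hdiag : ∀ z ∈ bidisk, G (z, (conj z.1, conj z.2)) = 0 := fun z hz => by
    have h1 := hσ.inner_szego_self ⟨z, hz⟩
    have h2 : (1 - conj (α : ℂ) * φ z) * (1 - α * conj (φ z)) =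
        ((‖(α : ℂ) - φ z‖ ^ 2 : ℝ) : ℂ) := by
      rw [Complex.ofReal_pow, ← Complex.mul_conj', map_sub]
      linear_combination (1 - φ z * conj (φ z)) * (-1 : ℂ) * coe_mul_conj_coe α
    have h3 : (‖(α : ℂ) - φ z‖ ^ 2 : ℝ) ≠ 0 :=
      pow_ne_zero 2 (norm_ne_zero_iff.2 (sub_ne_zero.2 (hφ.ne_circle hα hz).symm))
    simp only [G, hconj]
    rw [← szego_eq_cauchyKernel ⟨z, hz⟩, hA, h2, Complex.mul_conj', Complex.mul_conj',
      Complex.mul_conj']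
    push_cast at h1 h3 ⊢
    rw [mul_assoc, h1, mul_div_cancel₀ _ (by exact_mod_cast h3), sub_self]
  have h1 := eq_zero_of_diagonal_prod hG hdiag z.2 (conj_mem_bidisk w.2)
  simp only [G, hconj] at h1
  rw [← szego_eq_cauchyKernel z, ← szego_eq_cauchyKernel w, hA] at h1
  rw [mul_one_div, eq_div_iff (mul_ne_zero (one_sub_mul_ne_zero_of_norm_lt z.2.1 w.2.1)
    (one_sub_mul_ne_zero_of_norm_lt z.2.2 w.2.2))]
  linear_combination h1

end Clark

/-! ### Model spaces and the Clark embedding -/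

section Model

variable {φ : ℂ × ℂ → ℂ}

theorem mem_modelSpace_iff {f : L2 torusMeasure} :
    f ∈ modelSpace φ ↔ f ∈ hardy ∧
      ∀ g ∈ hardy, ⟪mulOp torusMeasure (boundaryFunction φ) g, f⟫_ℂ = 0 := by
  rw [modelSpace, Submodule.mem_inf, Submodule.mem_orthogonal]
  refine and_congr_right fun _ => ⟨fun h g hg => h _ ⟨g, hg, rfl⟩, ?_⟩
  rintro h - ⟨g, hg, rfl⟩
  exact h g hg

/-- Against `φ g`, the kernel `k_w` gives `conj (φ(w) g(w))` and `φ k_w` gives `conj (g(w))` since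
`φ` is unimodular on the torus; the factor `conj (φ(w))` makes them cancel, so the projection acts
trivially. -/
theorem IsInner.coe_modelKernel (hφ : IsInner φ) (w : bidisk) :
    (modelKernel φ w : L2 torusMeasure) = toL2 torusMeasure (szego w) -
      conj (φ w) • mulOp torusMeasure (boundaryFunction φ) (toL2 torusMeasure (szego w)) := by
  have hmem : toL2 torusMeasure (szego w) -
      conj (φ w) • mulOp torusMeasure (boundaryFunction φ) (toL2 torusMeasure (szego w)) ∈
        modelSpace φ := by
    have hw := szego_mem_hardy w
    refine mem_modelSpace_iff.2 ⟨hardy.sub_mem hw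
      (hardy.smul_mem _ (hφ.mulOp_mem_hardy hw)), fun g hg => ?_⟩
    have h1 := hφ.cauchyEval_mulOp hg w
    rw [cauchyEval] at h1
    rw [inner_sub_right, inner_smul_right, inner_mulOp_mulOp_of_norm_eq_one
      hφ.memLp_boundaryFunction hφ.norm_boundaryFunction, ← inner_conj_symm, h1, map_mul,
      inner_conj_symm, sub_self]
  exact congrArg Subtype.val
    (Submodule.orthogonalProjectionOnto_mem_subspace_eq_self (⟨_, hmem⟩ : modelSpace φ))

theorem IsInner.inner_modelKernel (hφ : IsInner φ) (w : bidisk) (f : modelSpace φ) :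
    ⟪modelKernel φ w, f⟫_ℂ = cauchyEval w (f : L2 torusMeasure) := by
  rw [Submodule.coe_inner, hφ.coe_modelKernel, inner_sub_left, inner_smul_left,
    (mem_modelSpace_iff.1 f.2).2 _ (szego_mem_hardy w), mul_zero, sub_zero]

theorem IsInner.inner_modelKernel_modelKernel (hφ : IsInner φ) (z w : bidisk) :
    ⟪modelKernel φ z, modelKernel φ w⟫_ℂ =
      (1 - φ z * conj (φ w)) * (1 / ((1 - z.1.1 * conj w.1.1) * (1 - z.1.2 * conj w.1.2))) := by
  have h1 := hφ.cauchyEval_mulOp (szego_mem_hardy w) z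
  have h2 := cauchyEval_szego z w
  rw [cauchyEval] at h1 h2
  rw [hφ.inner_modelKernel, hφ.coe_modelKernel, cauchyEval, inner_sub_right, inner_smul_right,
    h1, cauchyEval, h2]
  ring

theorem IsInner.eq_of_inner_modelKernel (hφ : IsInner φ) {f g : modelSpace φ}
    (h : ∀ w, ⟪modelKernel φ w, f⟫_ℂ = ⟪modelKernel φ w, g⟫_ℂ) : f = g := by
  refine Subtype.ext (eq_of_cauchyEval (mem_modelSpace_iff.1 f.2).1
    (mem_modelSpace_iff.1 g.2).1 fun z _ => ?_)
  rw [← hφ.inner_modelKernel, ← hφ.inner_modelKernel, h]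

/-- An element of `K_φ` orthogonal to all kernels has vanishing Cauchy integral. -/
theorem IsInner.denseRange_modelKernel (hφ : IsInner φ) :
    DenseRange (Finsupp.linearCombination ℂ (modelKernel φ)) := by
  have h1 : Dense (Submodule.span ℂ (range (modelKernel φ)) : Set (modelSpace φ)) := by
    rw [Submodule.dense_iff_topologicalClosure_eq_top, Submodule.topologicalClosure_eq_top_iff,
      Submodule.eq_bot_iff]
    intro f hf
    refine hφ.eq_of_inner_modelKernel fun w => ?_
    rw [inner_zero_right]
    exact hf _ (Submodule.subset_span ⟨w, rfl⟩)
  rw [← Finsupp.range_linearCombination] at h1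
  exact h1

theorem _root_.Finsupp.norm_linearCombination_eq {ι E F : Type*} [NormedAddCommGroup E]
    [InnerProductSpace ℂ E] [NormedAddCommGroup F] [InnerProductSpace ℂ F] {u : ι → E} {v : ι → F}
    (h : ∀ i j, ⟪u i, u j⟫_ℂ = ⟪v i, v j⟫_ℂ) (c : ι →₀ ℂ) :
    ‖Finsupp.linearCombination ℂ u c‖ = ‖Finsupp.linearCombination ℂ v c‖ := by
  have h1 : ⟪Finsupp.linearCombination ℂ u c, Finsupp.linearCombination ℂ u c⟫_ℂ =
      ⟪Finsupp.linearCombination ℂ v c, Finsupp.linearCombination ℂ v c⟫_ℂ := by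
    simp only [Finsupp.linearCombination_apply, Finsupp.sum, sum_inner, inner_sum,
      inner_smul_left, inner_smul_right, h]
  rw [← pow_left_inj₀ (norm_nonneg _) (norm_nonneg _) two_ne_zero, @norm_sq_eq_re_inner ℂ,
    @norm_sq_eq_re_inner ℂ, h1]

end Model

section Embedding

variable {φ : ℂ × ℂ → ℂ} {α : Circle} {σ : Measure Torus} [IsFiniteMeasure σ]

/-- The polarized Clark formula says that the two families have the same Gram matrix. -/
theorem IsClarkMeasure.norm_linearCombination (hφ : IsInner φ) (hα : ∃ z ∈ bidisk, φ z ≠ α)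
    (hσ : IsClarkMeasure φ α σ) (c : bidisk →₀ ℂ) :
    ‖Finsupp.linearCombination ℂ
        (fun w : bidisk => (1 - (α : ℂ) * conj (φ w)) • toL2 σ (szego w)) c‖ =
      ‖Finsupp.linearCombination ℂ (modelKernel φ) c‖ := by
  refine Finsupp.norm_linearCombination_eq (fun z w => ?_) c
  rw [hφ.inner_modelKernel_modelKernel, ← hσ.inner_szego hφ hα, inner_smul_left, inner_smul_right]
  simp only [map_sub, map_one, map_mul, Complex.conj_conj]
  ring

/-- The extension by continuity is meaningful because the kernels span a dense subspace and the norm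
bound holds with constant `1`. -/
theorem IsClarkMeasure.clarkEmbedding_modelKernel (hφ : IsInner φ) (hα : ∃ z ∈ bidisk, φ z ≠ α)
    (hσ : IsClarkMeasure φ α σ) (w : bidisk) :
    clarkEmbedding φ α σ (modelKernel φ w) =
      (1 - (α : ℂ) * conj (φ w)) • toL2 σ (szego w) := by
  have h := LinearMap.extendOfNorm_eq
    (f := Finsupp.linearCombination ℂ
      (fun w : bidisk => (1 - (α : ℂ) * conj (φ w)) • toL2 σ (szego w)))
    hφ.denseRange_modelKernel
    ⟨1, fun c => by rw [one_mul, hσ.norm_linearCombination hφ hα]⟩ (Finsupp.single w 1)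
  rwa [Finsupp.linearCombination_single, Finsupp.linearCombination_single, one_smul,
    one_smul] at h

theorem IsClarkMeasure.norm_clarkEmbedding (hφ : IsInner φ) (hα : ∃ z ∈ bidisk, φ z ≠ α)
    (hσ : IsClarkMeasure φ α σ) (f : modelSpace φ) : ‖clarkEmbedding φ α σ f‖ = ‖f‖ := by
  have hc : IsClosed {f | ‖clarkEmbedding φ α σ f‖ = ‖f‖} :=
    isClosed_eq (clarkEmbedding φ α σ).continuous.norm continuous_norm
  refine hφ.denseRange_modelKernel.induction_on
    (p := fun f => ‖clarkEmbedding φ α σ f‖ = ‖f‖) f hc fun c => ?_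
  rw [← hσ.norm_linearCombination hφ hα]
  congr 1
  exact LinearMap.extendOfNorm_eq hφ.denseRange_modelKernel
    ⟨1, fun c => by rw [one_mul, hσ.norm_linearCombination hφ hα]⟩ c

theorem IsClarkMeasure.adjoint_comp_clarkEmbedding (hφ : IsInner φ)
    (hα : ∃ z ∈ bidisk, φ z ≠ α) (hσ : IsClarkMeasure φ α σ) :
    ContinuousLinearMap.adjoint (clarkEmbedding φ α σ) ∘L clarkEmbedding φ α σ = 1 :=
  (ContinuousLinearMap.norm_map_iff_adjoint_comp_self _).1 (hσ.norm_clarkEmbedding hφ hα)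

theorem IsClarkMeasure.clarkEmbedding_comp_adjoint (hφ : IsInner φ)
    (hα : ∃ z ∈ bidisk, φ z ≠ α) (hσ : IsClarkMeasure φ α σ)
    (hJ : Function.Surjective (clarkEmbedding φ α σ)) :
    clarkEmbedding φ α σ ∘L ContinuousLinearMap.adjoint (clarkEmbedding φ α σ) = 1 := by
  ext1 y
  obtain ⟨x, rfl⟩ := hJ y
  exact congrArg (clarkEmbedding φ α σ)
    (DFunLike.congr_fun (hσ.adjoint_comp_clarkEmbedding hφ hα) x)

end Embedding

/-! ### The function `ψ¹_α` -/

section Psi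

variable {φ : ℂ × ℂ → ℂ} {α : Circle}

theorem zero_fst_mem_bidisk {t : ℂ} (ht : ‖t‖ < 1) : ((0, t) : ℂ × ℂ) ∈ bidisk := ⟨by simp, ht⟩

/-- The definition of `ψ¹_α` with denominators cleared; in this form it also covers `z₁ = 0`. The
denominator is nonzero because `φ` omits the value `α`. -/
theorem IsInner.mul_psi_mul_sub (hφ : IsInner φ) (hα : ∃ z ∈ bidisk, φ z ≠ α) {z : ℂ × ℂ}
    (hz : z ∈ bidisk) : z.1 * psi φ α z * (α - φ (0, z.2)) = φ z - φ (0, z.2) := by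
  have h1 := one_sub_conj_circle_mul_ne_zero (hφ.ne_circle hα (zero_fst_mem_bidisk hz.2))
  have h2 : z.1 * backwardShift φ z = φ z - φ (0, z.2) := by
    have h := sub_smul_dslope (fun s => φ (s, z.2)) 0 z.1
    rwa [sub_zero, smul_eq_mul] at h
  have h3 : (α : ℂ) - φ (0, z.2) = α * (1 - conj (α : ℂ) * φ (0, z.2)) := by
    linear_combination (-φ (0, z.2)) * -coe_mul_conj_coe α
  rw [psi, h3, ← h2]
  field_simp
  linear_combination z.1 * backwardShift φ z * coe_mul_conj_coe α

/-- Off `z₁ = 0` the function is an ordinary quotient of holomorphic functions; across `z₁ = 0` the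
removable singularity theorem is used only on slices with `z₂` fixed. -/
theorem IsInner.sliceHolomorphic_psi (hφ : IsInner φ) (hα : ∃ z ∈ bidisk, φ z ≠ α) :
    SliceHolomorphic (psi φ α) := by
  have hs := sliceHolomorphic_of_differentiableOn hφ.differentiableOn
  have hdrop : DifferentiableOn ℂ (fun z : ℂ × ℂ => φ (0, z.2)) bidisk :=
    hφ.differentiableOn.comp (f := fun z : ℂ × ℂ => ((0 : ℂ), z.2)) (by fun_prop)
      fun z hz => zero_fst_mem_bidisk hz.2
  have hne : ∀ z ∈ bidisk, 1 - conj (α : ℂ) * φ (0, z.2) ≠ 0 := fun z hz =>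
    one_sub_conj_circle_mul_ne_zero (hφ.ne_circle hα (zero_fst_mem_bidisk hz.2))
  have hmain : DifferentiableOn ℂ (psi φ α) {z | z ∈ bidisk ∧ z.1 ≠ 0} := by
    have h1 : DifferentiableOn ℂ (fun z : ℂ × ℂ => conj (α : ℂ) *
        ((z.1⁻¹ * (φ z - φ (0, z.2))) * (1 - conj (α : ℂ) * φ (0, z.2))⁻¹))
        {z | z ∈ bidisk ∧ z.1 ≠ 0} := by
      have hinv : DifferentiableOn ℂ (fun z : ℂ × ℂ => z.1⁻¹) {z | z ∈ bidisk ∧ z.1 ≠ 0} :=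
        fun z hz => (differentiableAt_fst.inv hz.2).differentiableWithinAt
      have hnum : DifferentiableOn ℂ (fun z : ℂ × ℂ => φ z - φ (0, z.2))
          {z | z ∈ bidisk ∧ z.1 ≠ 0} :=
        (hφ.differentiableOn.fun_sub hdrop).mono fun _ h => h.1
      have hden : DifferentiableOn ℂ (fun z : ℂ × ℂ => 1 - conj (α : ℂ) * φ (0, z.2))
          {z | z ∈ bidisk ∧ z.1 ≠ 0} :=
        ((hdrop.const_mul _).const_sub _).mono fun _ h => h.1
      exact ((hinv.fun_mul hnum).fun_mul (hden.inv fun z hz => hne z hz.1)).const_mul _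
    refine h1.congr fun z hz => ?_
    rw [psi, backwardShift, dslope_of_ne _ hz.2, slope_def_field, sub_zero, div_eq_inv_mul _ z.1,
      ← div_eq_mul_inv]
  refine ⟨hmain.continuousOn, fun t ht => ?_, fun s hs0 hs1 => ?_⟩
  · have h1 : DifferentiableOn ℂ (dslope (fun s => φ (s, t)) 0) (Metric.ball 0 1) :=
      (Complex.differentiableOn_dslope (Metric.ball_mem_nhds 0 one_pos)).2 (hs.left t ht)
    exact ((h1.div_const (1 - conj (α : ℂ) * φ (0, t))).const_mul (conj (α : ℂ))).congr
      fun s _ => rfl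
  · exact hmain.comp (f := fun t => (s, t)) (by fun_prop) fun t ht =>
      ⟨⟨hs1, by simpa using ht⟩, hs0⟩

theorem IsInner.isBoundaryFunction_psi (hφ : IsInner φ) (hα : ∃ z ∈ bidisk, φ z ≠ α)
    (hψ : BoundedOnBidisk (psi φ α)) :
    IsBoundaryFunction (psi φ α) (boundaryFunction (psi φ α)) ∧
      MemLp (boundaryFunction (psi φ α)) ∞ torusMeasure := by
  obtain ⟨p, hp, hp'⟩ := (hφ.sliceHolomorphic_psi hα).exists_boundaryFunction hψ
  rw [hp.eq_boundaryFunction]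
  exact ⟨hp, hp'⟩

theorem IsInner.exists_boundaryFunction_zero_fst (hφ : IsInner φ) :
    ∃ q : L2 torusMeasure, q ∈ hardy ∧ MemLp q ∞ torusMeasure ∧
      ∀ z : bidisk, cauchyEval z q = φ (0, z.1.2) := by
  have hdrop : DifferentiableOn ℂ (fun z : ℂ × ℂ => φ (0, z.2)) bidisk :=
    hφ.differentiableOn.comp (f := fun z : ℂ × ℂ => ((0 : ℂ), z.2)) (by fun_prop)
      fun z hz => zero_fst_mem_bidisk hz.2
  obtain ⟨q, hq, hq'⟩ := (sliceHolomorphic_of_differentiableOn hdrop).exists_boundaryFunction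
    ⟨1, fun z hz => hφ.norm_le_one (zero_fst_mem_bidisk hz.2)⟩
  rw [isBoundaryFunction_iff] at hq
  exact ⟨q, hq.1, hq', fun z => (hq.2 z).symm⟩

end Psi

/-! ### The Clark unitary -/

section Unitary

variable {φ : ℂ × ℂ → ℂ} {α : Circle}

/-- The matrix entries of `U¹_α` against the reproducing kernels. -/
theorem IsInner.inner_modelKernel_clarkUnitary (hφ : IsInner φ) (hα : ∃ z ∈ bidisk, φ z ≠ α)
    (hψ : BoundedOnBidisk (psi φ α)) (w : bidisk) (f : modelSpace φ) :
    ⟪modelKernel φ w, clarkUnitary φ α f⟫_ℂ =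
      w.1.1 * ⟪modelKernel φ w, f⟫_ℂ + (1 - conj (α : ℂ) * φ w) *
        ⟪mulOp torusMeasure (boundaryFunction (psi φ α)) (toL2 torusMeasure (szego (dropOne w))),
          (f : L2 torusMeasure)⟫_ℂ := by
  obtain ⟨q, hq, hq', hqe⟩ := hφ.exists_boundaryFunction_zero_fst
  obtain ⟨hp, hp'⟩ := hφ.isBoundaryFunction_psi hα hψ
  obtain ⟨hp, hpe⟩ := isBoundaryFunction_iff.1 hp
  obtain ⟨hf, hfφ⟩ := mem_modelSpace_iff.1 f.2
  set b := boundaryFunction φ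
  set p := boundaryFunction (psi φ α)
  set κ := toL2 torusMeasure (szego (dropOne w)) with hκ
  set e : L2 torusMeasure →L[ℂ] L2 torusMeasure := mulOp torusMeasure coordOne with he
  have hκm : κ ∈ hardy := szego_mem_hardy _
  have hw : toL2 torusMeasure (szego w) ∈ hardy := szego_mem_hardy w
  obtain ⟨hqκ, hqκe⟩ := mulOp_mem_hardy_and_cauchyEval hq hq' hκm
  obtain ⟨hpκ, hpκe⟩ := mulOp_mem_hardy_and_cauchyEval hp hp' hκm
  obtain ⟨hpqκ, hpqκe⟩ := mulOp_mem_hardy_and_cauchyEval hp hp' hqκ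
  set X := mulOp torusMeasure p κ
  set Y := mulOp torusMeasure p (mulOp torusMeasure q κ)
  have hXY : (α : ℂ) • X - Y ∈ hardy := hardy.sub_mem (hardy.smul_mem _ hpκ) hpqκ
  -- The relation `φ = φ(0,·) + z₁ (α - φ(0,·)) ψ`, multiplied by `κ = k_(0,w₂)` and transferred to
  -- the torus by comparing Cauchy integrals.
  have hbκ : mulOp torusMeasure b κ = mulOp torusMeasure q κ + e ((α : ℂ) • X - Y) := by
    refine eq_of_cauchyEval (hφ.mulOp_mem_hardy hκm)
      (hardy.add_mem hqκ (coordOne_mul_mem_hardy hXY)) fun z _ => ?_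
    have h1 := cauchyEval_coordOne_mul hXY z
    have h2 := hφ.mul_psi_mul_sub hα z.2
    have h3 : cauchyEval z ((α : ℂ) • X - Y) =
        α * cauchyEval z X - cauchyEval z Y := by
      rw [cauchyEval, inner_sub_right, inner_smul_right]
    have h4 : cauchyEval z (mulOp torusMeasure q κ + e ((α : ℂ) • X - Y)) =
        cauchyEval z (mulOp torusMeasure q κ) + cauchyEval z (e ((α : ℂ) • X - Y)) :=
      inner_add_right _ _ _
    rw [hφ.cauchyEval_mulOp hκm, h4, he, h1, h3, hqκe, hqe, hpκe, hpqκe, hqκe, hqe, ← hpe]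
    linear_combination -cauchyEval z κ * h2
  -- Projecting onto functions of `z₂` means setting `z₁ = 0`, which turns `φ k_w` into `φ(0,·)
  -- k_(0,w₂)`.
  have hproj : hardyTwo.starProjection
      (mulOp torusMeasure b (toL2 torusMeasure (szego w))) = mulOp torusMeasure q κ := by
    refine eq_of_cauchyEval (hardyTwo_le_hardy (Submodule.starProjection_apply_mem _ _)) hqκ
      fun z _ => ?_
    rw [cauchyEval_starProjection_hardyTwo, hφ.cauchyEval_mulOp hw, hqκe, hqe, cauchyEval_szego,
      cauchyEval_szego]
    simp [dropOne]
  have hqκ2 : mulOp torusMeasure q κ ∈ hardyTwo := by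
    rw [← hproj]
    exact Submodule.starProjection_apply_mem _ _
  have hgen : ∀ g : C(Torus, ℂ), MemLp g ∞ torusMeasure := memLp_top_continuousMap
  have hconjp := memLp_top_conj hp'
  have hbw : mulOp torusMeasure b (toL2 torusMeasure (szego w)) =
      conj w.1.1 • e (mulOp torusMeasure b (toL2 torusMeasure (szego w))) +
        mulOp torusMeasure b κ := by
    have h1 : toL2 torusMeasure (szego w) =
        conj w.1.1 • e (toL2 torusMeasure (szego w)) + κ := by
      rw [he, mulOp_toL2, ← toL2_smul, conj_smul_coordOne_mul_szego, toL2_sub, hκ,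
        sub_add_cancel]
    conv_lhs => rw [h1]
    rw [map_add, map_smul, he, mulOp_comm hφ.memLp_boundaryFunction (hgen coordOne)]
  have hee : ∀ x y : L2 torusMeasure, ⟪e x, e y⟫_ℂ = ⟪x, y⟫_ℂ :=
    inner_mulOp_mulOp_of_norm_eq_one (hgen coordOne) (.of_forall fun ζ => Circle.norm_coe ζ.1)
  have hI1 : ⟪toL2 torusMeasure (szego w), e f⟫_ℂ =
      w.1.1 * ⟪toL2 torusMeasure (szego w), (f : L2 torusMeasure)⟫_ℂ :=
    cauchyEval_coordOne_mul hf w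
  -- Split `φ k_w = conj w₁ z₁ φ k_w + φ κ`. The first term drops out because `f` is orthogonal to
  -- `φ H²`; in the second the part `φ(0,·) κ` depends on `z₂` alone, hence is orthogonal to `z₁ f`,
  -- and only `z₁ (α X - Y)` remains.
  have hI2 : ⟪mulOp torusMeasure b (toL2 torusMeasure (szego w)), e f⟫_ℂ =
      conj (α : ℂ) * ⟪X, (f : L2 torusMeasure)⟫_ℂ - ⟪Y, (f : L2 torusMeasure)⟫_ℂ := by
    have h0 : ⟪mulOp torusMeasure q κ, e f⟫_ℂ = 0 := by
      rw [he, inner_mulOp_right (hgen coordOne)]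
      exact Submodule.inner_left_of_mem_orthogonal hf (star_coordOne_mul_mem_orthogonal hqκ2)
    rw [hbw, inner_add_left, inner_smul_left, hee, hfφ _ hw, mul_zero, zero_add, hbκ,
      inner_add_left, h0, zero_add, hee, inner_sub_left, inner_smul_left]
  have hI3 : ⟪hardyTwo.starProjection (toL2 torusMeasure (szego w)),
      mulOp torusMeasure (fun ζ => conj (p ζ)) (f : L2 torusMeasure)⟫_ℂ =
        ⟪X, (f : L2 torusMeasure)⟫_ℂ := by
    rw [starProjection_hardyTwo_szego, ← inner_mulOp_left hp']
  have hI4 : ⟪hardyTwo.starProjection (mulOp torusMeasure b (toL2 torusMeasure (szego w))),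
      mulOp torusMeasure (fun ζ => conj (p ζ)) (f : L2 torusMeasure)⟫_ℂ =
        ⟪Y, (f : L2 torusMeasure)⟫_ℂ := by
    rw [hproj, ← inner_mulOp_left hp']
  have hpr : ∀ x : L2 torusMeasure, ⟪modelKernel φ w, projModel φ x⟫_ℂ =
      ⟪(modelKernel φ w : L2 torusMeasure), x⟫_ℂ := fun x =>
    Submodule.inner_orthogonalProjectionOnto_eq_of_mem_left _ _
  have hU : clarkUnitary φ α f = projModel φ (e f) +
      projModel φ (hardyTwo.starProjection
        (mulOp torusMeasure (fun ζ => conj (p ζ)) (f : L2 torusMeasure))) := rfl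
  have hK : ⟪modelKernel φ w, f⟫_ℂ =
      ⟪toL2 torusMeasure (szego w), (f : L2 torusMeasure)⟫_ℂ := hφ.inner_modelKernel w f
  -- The shift contributes `-φ(w) (conj α ⟨X, f⟩ - ⟨Y, f⟩)` and the perturbation `⟨X, f⟩ - φ(w) ⟨Y,
  -- f⟩`: the terms with `Y` cancel and those with `X` combine to the factor `1 - conj α φ(w)`.
  rw [hU, inner_add_right, hpr, hpr, hφ.coe_modelKernel, inner_sub_left, inner_smul_left, hI1,
    hI2, inner_sub_left, inner_smul_left, ← Submodule.inner_starProjection_left_eq_right,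
    ← Submodule.inner_starProjection_left_eq_right, hI3, hI4, Complex.conj_conj, hK]
  ring

variable {σ : Measure Torus} [IsFiniteMeasure σ]

/-- The adjoint of the Clark embedding maps `conj z₁ k_(0, w₂)` to `ψ¹_α k_(0, w₂)`. -/
theorem IsClarkMeasure.adjoint_clarkEmbedding_star_coordOne (hφ : IsInner φ)
    (hα : ∃ z ∈ bidisk, φ z ≠ α) (hσ : IsClarkMeasure φ α σ) (hψ : BoundedOnBidisk (psi φ α))
    (w : bidisk) :
    (ContinuousLinearMap.adjoint (clarkEmbedding φ α σ)
        (toL2 σ (star coordOne * szego (dropOne w))) : L2 torusMeasure) =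
      mulOp torusMeasure (boundaryFunction (psi φ α)) (toL2 torusMeasure (szego (dropOne w))) := by
  obtain ⟨hp, hp'⟩ := hφ.isBoundaryFunction_psi hα hψ
  obtain ⟨hp, hpe⟩ := isBoundaryFunction_iff.1 hp
  obtain ⟨hpκ, hpκe⟩ := mulOp_mem_hardy_and_cauchyEval hp hp' (szego_mem_hardy (dropOne w))
  refine eq_of_cauchyEval (mem_modelSpace_iff.1 (Subtype.property _)).1 hpκ fun z hz => ?_
  rw [hpκe, ← hpe, cauchyEval_szego, ← hφ.inner_modelKernel,
    ContinuousLinearMap.adjoint_inner_right, hσ.clarkEmbedding_modelKernel hφ hα,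
    inner_smul_left]
  simp only [map_sub, map_one, map_mul, Complex.conj_conj]
  -- The factor `z₁` turns `conj ζ₁` into a difference of Szegő kernels, whose inner products the
  -- polarized Clark formula supplies. Dividing by `z₁` later is allowed since Cauchy integrals need
  -- comparing only off `z₁ = 0`.
  have h1 : z.1.1 * ⟪toL2 σ (szego z), toL2 σ (star coordOne * szego (dropOne w))⟫_ℂ =
      ⟪toL2 σ (szego z), toL2 σ (szego (dropOne w))⟫_ℂ -
        ⟪toL2 σ (szego (dropOne z)), toL2 σ (szego (dropOne w))⟫_ℂ := by
    rw [← inner_sub_left, ← toL2_sub, ← conj_smul_coordOne_mul_szego, toL2_smul, inner_smul_left,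
      Complex.conj_conj, ← mulOp_toL2, inner_toL2_mulOp, star_star]
  have h2 := hσ.inner_szego hφ hα z (dropOne w)
  have h3 := hσ.inner_szego hφ hα (dropOne z) (dropOne w)
  have h4 := hφ.mul_psi_mul_sub hα z.2
  have hA := one_sub_conj_circle_mul_ne_zero (hφ.ne_circle hα (zero_fst_mem_bidisk z.2.2))
  have hB := one_sub_circle_mul_conj_ne_zero (hφ.ne_circle hα (zero_fst_mem_bidisk w.2.2))
  simp only [dropOne, map_zero, mul_zero, sub_zero, one_mul] at h1 h2 h3 ⊢
  refine mul_left_cancel₀ (mul_ne_zero (mul_ne_zero hz hA) hB) ?_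
  symm
  linear_combination
    1 / (1 - z.1.2 * conj w.1.2) * (1 - α * conj (φ (0, w.1.2))) * conj (α : ℂ) * h4 -
    1 / (1 - z.1.2 * conj w.1.2) * ((1 - α * conj (φ (0, w.1.2))) * z.1.1 * psi φ α z +
      (φ z - φ (0, z.1.2)) * conj (φ (0, w.1.2))) * coe_mul_conj_coe α -
    (1 - conj (α : ℂ) * φ z) * (1 - conj (α : ℂ) * φ (0, z.1.2)) *
      (1 - α * conj (φ (0, w.1.2))) * h1 -
    (1 - conj (α : ℂ) * φ (0, z.1.2)) * h2 + (1 - conj (α : ℂ) * φ z) * h3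

/-- The Clark embedding intertwines `U¹_α` with multiplication by the first coordinate. -/
theorem IsClarkMeasure.clarkUnitary_eq (hφ : IsInner φ)
    (hα : ∃ z ∈ bidisk, φ z ≠ α) (hσ : IsClarkMeasure φ α σ) (hψ : BoundedOnBidisk (psi φ α)) :
    clarkUnitary φ α = ContinuousLinearMap.adjoint (clarkEmbedding φ α σ) ∘L
      mulOp σ coordOne ∘L clarkEmbedding φ α σ := by
  ext1 f
  refine hφ.eq_of_inner_modelKernel fun w => ?_
  -- Since `J` preserves inner products, pairing `J f` with `k_w` in `L²(σ)` recovers the value of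
  -- `f` at `w` up to this factor.
  have h1 : (1 - conj (α : ℂ) * φ w) * ⟪toL2 σ (szego w), clarkEmbedding φ α σ f⟫_ℂ =
      ⟪modelKernel φ w, f⟫_ℂ := by
    have h2 := (ContinuousLinearMap.inner_map_map_iff_adjoint_comp_self _).2
      (hσ.adjoint_comp_clarkEmbedding hφ hα) (modelKernel φ w) f
    rw [hσ.clarkEmbedding_modelKernel hφ hα, inner_smul_left] at h2
    simpa using h2
  have h3 : ⟪toL2 σ (star coordOne * szego (dropOne w)), clarkEmbedding φ α σ f⟫_ℂ =
      ⟪mulOp torusMeasure (boundaryFunction (psi φ α)) (toL2 torusMeasure (szego (dropOne w))),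
        (f : L2 torusMeasure)⟫_ℂ := by
    rw [← ContinuousLinearMap.adjoint_inner_left, Submodule.coe_inner,
      hσ.adjoint_clarkEmbedding_star_coordOne hφ hα hψ]
  rw [hφ.inner_modelKernel_clarkUnitary hα hψ, ContinuousLinearMap.comp_apply,
    ContinuousLinearMap.adjoint_inner_right, hσ.clarkEmbedding_modelKernel hφ hα,
    ContinuousLinearMap.comp_apply, inner_smul_left, inner_toL2_mulOp, star_coordOne_mul_szego,
    toL2_add, toL2_smul, inner_add_left, inner_smul_left, h3, ← h1]
  simp only [map_sub, map_one, map_mul, Complex.conj_conj]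
  ring

end Unitary

end ClarkBidisk

end

/-! ### Conjugation by the unitary Clark embedding -/

open ClarkBidisk in
theorem mainTheorem6 (φ : ℂ × ℂ → ℂ) (hφ : IsInner φ) (α : Circle)
    (hα : ∃ z ∈ bidisk, φ z ≠ α)
    (σ : Measure Torus) [IsFiniteMeasure σ] (hσ : IsClarkMeasure φ α σ)
    (hJ : Function.Surjective (clarkEmbedding φ α σ))
    (hψ : BoundedOnBidisk (psi φ α)) :
    clarkUnitary φ α ∈ unitary (modelSpace φ →L[ℂ] modelSpace φ) ∧
      mulOp σ (fun ζ => (ζ.1 : ℂ)) =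
        clarkEmbedding φ α σ ∘L clarkUnitary φ α ∘L
          ContinuousLinearMap.adjoint (clarkEmbedding φ α σ) := by
  -- With `U = J* M J` and both `J* J = 1` and `J J* = 1`, unitarity of `M` passes to `U`, and `J U
  -- J*` collapses to `M`.
  have hU := hσ.clarkUnitary_eq hφ hα hψ
  have h1 := hσ.adjoint_comp_clarkEmbedding hφ hα
  have h2 := hσ.clarkEmbedding_comp_adjoint hφ hα hJ
  have hM : mulOp σ coordOne ∈ unitary (L2 σ →L[ℂ] L2 σ) :=
    mulOp_mem_unitary (memLp_top_continuousMap coordOne) (.of_forall fun ζ => Circle.norm_coe ζ.1)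
  set J := clarkEmbedding φ α σ
  have h1' : ∀ x, ContinuousLinearMap.adjoint J (J x) = x := fun x => DFunLike.congr_fun h1 x
  have h2' : ∀ x, J (ContinuousLinearMap.adjoint J x) = x := fun x => DFunLike.congr_fun h2 x
  refine ⟨?_, ?_⟩
  · obtain ⟨hM1, hM2⟩ := Unitary.mem_iff.1 hM
    rw [hU, Unitary.mem_iff, ContinuousLinearMap.star_eq_adjoint,
      ContinuousLinearMap.adjoint_comp, ContinuousLinearMap.adjoint_comp,
      ContinuousLinearMap.adjoint_adjoint]
    constructor
    · ext1 x
      have h3 := DFunLike.congr_fun hM1 (J x)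
      simp only [mul_apply_eq_comp, ContinuousLinearMap.comp_apply, h2'] at h3 ⊢
      rw [ContinuousLinearMap.star_eq_adjoint] at h3
      rw [h3]
      exact h1' x
    · ext1 x
      have h3 := DFunLike.congr_fun hM2 (J x)
      simp only [mul_apply_eq_comp, ContinuousLinearMap.comp_apply, h2'] at h3 ⊢
      rw [ContinuousLinearMap.star_eq_adjoint] at h3
      rw [h3]
      exact h1' x
  · rw [hU]
    ext1 y
    simp only [ContinuousLinearMap.comp_apply, h2']
    rfl
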